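/- Let $n\ge 3$ and let $s$ be an integer with $s\ge [n/2]+1$. Let $\mu>0$, $\frac{2}{n}\mu+\mu'\ge 0$, $\kappa>0$, put $\nu=\mu$, $\tilde\nu=\mu+\mu'$, and let $r_1>0$. Write $\hat f(\xi)=\int_{\mathbb{R}^n} f(x)e^{-ix\cdot\xi}\,dx$ and let $H^k_{(\infty)}$ be the space of all (complex-valued) $f\in H^k(\mathbb{R}^n)$ with $\operatorname{supp}\hat f\subset\{|\xi|\ge r_1\}$, with the norm $\|f\|_{H^k}=\big(\sum_{|\alpha|\le k}\|\partial^\alpha f\|_{L^2}^2\big)^{1/2}$. Let $X=H^s_{(\infty)}\times (H^{s-1}_{(\infty)})^n$, with elements $u={}^\top(\phi,m)$ and norm $\|u\|_X=(\|\phi\|_{H^s}^2+\|m\|_{H^{s-1}}^2)^{1/2}$. Consider the linearized Navier–Stokes–Korteweg system $\partial_t u+Au=0$ with $$A\begin{pmatrix}\phi\\ m\end{pmatrix}=\begin{pmatrix}\operatorname{div} m\\ -\kappa\nabla\Delta\phi-\nu\Delta m-\tilde\nu\nabla\operatorname{div} m\end{pmatrix}$$ (derivatives in the sense of distributions). Its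 solution operator $S_\infty(t)$, $t\ge0$, is the Fourier multiplier with matrix $$\begin{pmatrix} \dfrac{\lambda_+e^{\lambda_-t}-\lambda_-e^{\lambda_+t}}{\lambda_+-\lambda_-} & -i\,\dfrac{e^{\lambda_+t}-e^{\lambda_-t}}{\lambda_+-\lambda_-}\,{}^\top\xi\\[2ex] -i\kappa|\xi|^2\,\dfrac{e^{\lambda_+t}-e^{\lambda_-t}}{\lambda_+-\lambda_-}\,\xi & e^{-\nu|\xi|^2t}I_n+\Big(\dfrac{\lambda_+e^{\lambda_+t}-\lambda_-e^{\lambda_-t}}{\lambda_+-\lambda_-}-e^{-\nu|\xi|^2t}\Big)\dfrac{\xi\,{}^\top\xi}{|\xi|^2}\end{pmatrix},$$ $$\lambda_\pm(\xi)=-\tfrac{\nu+\tilde\nu}{2}\big(|\xi|^2\pm|\xi|^2\sqrt{1-K^2}\big),\qquad K=\tfrac{2\sqrt\kappa}{\nu+\tilde\nu},$$ where the quotients are replaced by their limits when $\lambda_+=\lambda_-$. Then $\{S_\infty(t)\}_{t\ge0}$ is a well-defined family of bounded linear operators on $X$ and: 1. $\{S_\infty(t)\}_{t\ge 0}$ is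 a $C^0$-semigroup on $X$. 2. Its infinitesimal generator is $-A$, with domain $\{u\in X: Au\in X\}$. 3. For every $T>0$ and every $u_0\in C([0,T];X)$ (in particular for every constant $u_0\in X$) the function $t\mapsto S_\infty(t)u_0(t)$ belongs to $C([0,T];X)$. 4. There is a constant $C>0$, independent of $t$, such that $\|S_\infty(t)u_0\|_{X}\le C\|u_0\|_{X}$ for all $t\ge0$ and all $u_0\in X$. -/

import Mathlib

open MeasureTheory Filter Topology
open scoped FourierTransform SchwartzMap LineDeriv Laplacian NNReal ENNReal

noncomputable section

namespace NSK

/-- The space `ℝⁿ` with its Euclidean norm. -/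
abbrev Sp (n : ℕ) : Type := EuclideanSpace ℝ (Fin n)

/-- The complex Hilbert space `L²(ℝⁿ)`. -/
abbrev L2 (n : ℕ) : Type := Lp ℂ 2 (volume : Measure (Sp n))

/-- The `j`-th standard basis vector of `ℝⁿ`. -/
abbrev e {n : ℕ} (j : Fin n) : Sp n := EuclideanSpace.single j 1

/-- An `L²` function as a tempered distribution. -/
abbrev toDistr {n : ℕ} (f : L2 n) : 𝓢'(Sp n, ℂ) := Lp.toTemperedDistribution f

/-- The differential operator `∂^α = ∂₁^{α₁} ⋯ ∂ₙ^{αₙ}` on tempered distributions. -/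
def multiDeriv {n : ℕ} (α : Fin n → ℕ) : 𝓢'(Sp n, ℂ) →L[ℂ] 𝓢'(Sp n, ℂ) :=
  ((List.finRange n).map fun j =>
    (LineDeriv.lineDerivOpCLM ℂ 𝓢'(Sp n, ℂ) (e j : Sp n)) ^ α j).prod

/-- The multi-indices `α ∈ ℕⁿ` with `|α| ≤ k`. (Each entry is then at most `k`.) -/
abbrev MultiIndex (n k : ℕ) : Type := {α : Fin n → Fin (k + 1) // ∑ i, (α i : ℕ) ≤ k}

/-- The multi-index `0`. -/
def MultiIndex.zero (n k : ℕ) : MultiIndex n k := ⟨fun _ => 0, by simp⟩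

/-- The Sobolev space `H^k(ℝⁿ)` with the norm `‖f‖² = ∑_{|α| ≤ k} ‖∂^α f‖²_{L²}`. A function
`f ∈ H^k` is recorded as the family `(∂^α f)_{|α| ≤ k}` of its weak derivatives, all of which are
required to be in `L²`; the function itself is the entry at the multi-index `0`. -/
def H (n k : ℕ) : Submodule ℂ (PiLp 2 fun _ : MultiIndex n k => L2 n) where
  carrier := {F | ∀ α : MultiIndex n k,
    toDistr (F α) = multiDeriv (fun i => (α.1 i : ℕ)) (toDistr (F (MultiIndex.zero n k)))}
  zero_mem' := by
    intro α
    have h : toDistr (0 : L2 n) = 0 := map_zero (Lp.toTemperedDistributionCLM ℂ volume 2)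
    simp [h]
  add_mem' := by
    intro F G hF hG α
    have h : ∀ f g : L2 n, toDistr (f + g) = toDistr f + toDistr g := fun f g =>
      map_add (Lp.toTemperedDistributionCLM ℂ volume 2) f g
    simp only [PiLp.add_apply, h, map_add, hF α, hG α]
  smul_mem' := by
    intro c F hF α
    have h : ∀ f : L2 n, toDistr (c • f) = c • toDistr f := fun f =>
      map_smul (Lp.toTemperedDistributionCLM ℂ volume 2) c f
    simp only [PiLp.smul_apply, h, map_smul, hF α]

/-- The functions of `L²` whose Fourier transform `∫ f(x) e^{-i x·ξ} dx` is supported in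
`{|ξ| ≥ r}`. Mathlib's `𝓕 f η` is the integral `∫ f(x) e^{-2πi x·η} dx`, so that `ξ = 2πη`. -/
def L2High (n : ℕ) (r : ℝ) : Submodule ℂ (L2 n) where
  carrier := {f | ∀ᵐ η : Sp n, ‖(2 * Real.pi) • η‖ < r → (𝓕 f : L2 n) η = 0}
  zero_mem' := by
    have h : (𝓕 (0 : L2 n) : L2 n) = 0 := map_zero (Lp.fourierTransformₗᵢ (Sp n) ℂ)
    simp only [Set.mem_ofPred_eq, h]
    filter_upwards [Lp.coeFn_zero ℂ 2 (volume : Measure (Sp n))] with η hη _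
    exact hη
  add_mem' := by
    intro f g hf hg
    have h : (𝓕 (f + g) : L2 n) = 𝓕 f + 𝓕 g := map_add (Lp.fourierTransformₗᵢ (Sp n) ℂ) f g
    simp only [Set.mem_ofPred_eq, h] at hf hg ⊢
    filter_upwards [hf, hg, Lp.coeFn_add (𝓕 f : L2 n) (𝓕 g : L2 n)] with η h1 h2 h3 hr
    rw [h3, Pi.add_apply, h1 hr, h2 hr, add_zero]
  smul_mem' := by
    intro c f hf
    have h : (𝓕 (c • f) : L2 n) = c • 𝓕 f := map_smul (Lp.fourierTransformₗᵢ (Sp n) ℂ) c f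
    simp only [Set.mem_ofPred_eq, h] at hf ⊢
    filter_upwards [hf, Lp.coeFn_smul c (𝓕 f : L2 n)] with η h1 h2 hr
    rw [h2, Pi.smul_apply, h1 hr, smul_zero]

/-- The function underlying an element of `H^k`. -/
def evalZero (n k : ℕ) : (PiLp 2 fun _ : MultiIndex n k => L2 n) →ₗ[ℂ] L2 n where
  toFun F := F (MultiIndex.zero n k)
  map_add' _ _ := rfl
  map_smul' _ _ := rfl

/-- The high frequency space `H^k_(∞)`: the `f ∈ H^k` with Fourier support in `{|ξ| ≥ r}`,
with the norm of `H^k`. -/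
def HHigh (n k : ℕ) (r : ℝ) : Submodule ℂ (PiLp 2 fun _ : MultiIndex n k => L2 n) :=
  H n k ⊓ (L2High n r).comap (evalZero n k)

/-- The space `H^s_(∞) × (H^{s-1}_(∞))ⁿ` of pairs `(φ, m)`, with the norm
`(‖φ‖²_{H^s} + ∑_j ‖m_j‖²_{H^{s-1}})^{1/2}`. -/
abbrev X (n s : ℕ) (r : ℝ) : Type :=
  WithLp 2 (HHigh n s r × PiLp 2 fun _ : Fin n => HHigh n (s - 1) r)

instance (n k : ℕ) (r : ℝ) : NormedAddCommGroup (HHigh n k r) := Submodule.normedAddCommGroup _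

instance (n k : ℕ) (r : ℝ) : NormedSpace ℂ (HHigh n k r) := Submodule.normedSpace _

instance (n s : ℕ) (r : ℝ) : NormedAddCommGroup (X n s r) :=
  WithLp.instProdNormedAddCommGroup 2 _ _

instance (n s : ℕ) (r : ℝ) : NormedSpace ℂ (X n s r) :=
  WithLp.instProdNormedSpace 2 ℂ _ _

/-- The density component `φ ∈ L²` of `u = (φ, m)`. -/
def X.phi {n s : ℕ} {r : ℝ} (u : X n s r) : L2 n := evalZero n s u.fst

/-- The component `m_j ∈ L²` of `u = (φ, m)`. -/
def X.mom {n s : ℕ} {r : ℝ} (u : X n s r) (j : Fin n) : L2 n := evalZero n (s - 1) (u.snd j)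

/-- The divergence of a vector field of distributions. -/
def divergence {n : ℕ} (m : Fin n → 𝓢'(Sp n, ℂ)) : 𝓢'(Sp n, ℂ) := ∑ j, ∂_{(e j : Sp n)} (m j)

/-- `v = A u` in the sense of distributions, where
`A (φ, m) = (div m, -κ ∇Δφ - ν Δm - ν' ∇div m)`. As a relation on `X n s r` this is the graph of
the operator `A` with the domain of all `u ∈ X n s r` such that `A u ∈ X n s r`. -/
def IsA (ν ν' κ : ℝ) {n s : ℕ} {r : ℝ} (u v : X n s r) : Prop :=
  toDistr v.phi = divergence (fun j => toDistr (u.mom j)) ∧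
  ∀ j : Fin n, toDistr (v.mom j) =
    -((κ : ℂ) • ∂_{(e j : Sp n)} (Δ (toDistr u.phi)))
      - (ν : ℂ) • Δ (toDistr (u.mom j))
      - (ν' : ℂ) • ∂_{(e j : Sp n)} (divergence fun i => toDistr (u.mom i))

/-- The complex number `√(1 - K²)`, where `K = 2√κ / (ν + ν')`. -/
def rootK (ν ν' κ : ℝ) : ℂ := ((1 - (2 * √κ / (ν + ν')) ^ 2 : ℝ) : ℂ) ^ (1 / 2 : ℂ)

/-- `λ₊(ξ) = -((ν + ν')/2) (|ξ|² + |ξ|² √(1 - K²))`. -/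
def lamP (ν ν' κ : ℝ) {n : ℕ} (ξ : Sp n) : ℂ :=
  -(((ν + ν') / 2 : ℝ) : ℂ) * ((‖ξ‖ ^ 2 : ℝ) + (‖ξ‖ ^ 2 : ℝ) * rootK ν ν' κ)

/-- `λ₋(ξ) = -((ν + ν')/2) (|ξ|² - |ξ|² √(1 - K²))`. -/
def lamM (ν ν' κ : ℝ) {n : ℕ} (ξ : Sp n) : ℂ :=
  -(((ν + ν') / 2 : ℝ) : ℂ) * ((‖ξ‖ ^ 2 : ℝ) - (‖ξ‖ ^ 2 : ℝ) * rootK ν ν' κ)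

/-- `(a e^{bt} - b e^{at}) / (a - b)`, continuously extended to `a = b`. -/
def coefA (a b : ℂ) (t : ℝ) : ℂ :=
  if a = b then (1 - a * t) * Complex.exp (a * t)
  else (a * Complex.exp (b * t) - b * Complex.exp (a * t)) / (a - b)

/-- `(e^{at} - e^{bt}) / (a - b)`, continuously extended to `a = b`. -/
def coefB (a b : ℂ) (t : ℝ) : ℂ :=
  if a = b then t * Complex.exp (a * t)
  else (Complex.exp (a * t) - Complex.exp (b * t)) / (a - b)

/-- `(a e^{at} - b e^{bt}) / (a - b)`, continuously extended to `a = b`. -/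
def coefC (a b : ℂ) (t : ℝ) : ℂ :=
  if a = b then (1 + a * t) * Complex.exp (a * t)
  else (a * Complex.exp (a * t) - b * Complex.exp (b * t)) / (a - b)

/-- The entry `S₁₁` of the solution matrix of the linearized system at the frequency `ξ`. -/
def S11 (ν ν' κ : ℝ) {n : ℕ} (t : ℝ) (ξ : Sp n) : ℂ :=
  coefA (lamP ν ν' κ ξ) (lamM ν ν' κ ξ) t

/-- The entries of the row `S₁₂`. -/
def S12 (ν ν' κ : ℝ) {n : ℕ} (t : ℝ) (ξ : Sp n) (j : Fin n) : ℂ :=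
  -Complex.I * coefB (lamP ν ν' κ ξ) (lamM ν ν' κ ξ) t * (ξ j : ℂ)

/-- The entries of the column `S₂₁`. -/
def S21 (ν ν' κ : ℝ) {n : ℕ} (t : ℝ) (ξ : Sp n) (i : Fin n) : ℂ :=
  -Complex.I * (ξ i : ℂ) * κ * (‖ξ‖ ^ 2 : ℝ) * coefB (lamP ν ν' κ ξ) (lamM ν ν' κ ξ) t

/-- The entries of the block `S₂₂`. -/
def S22 (ν ν' κ : ℝ) {n : ℕ} (t : ℝ) (ξ : Sp n) (i j : Fin n) : ℂ :=
  Complex.exp (-(ν * ‖ξ‖ ^ 2 * t : ℝ)) * (if i = j then 1 else 0)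
    + (coefC (lamP ν ν' κ ξ) (lamM ν ν' κ ξ) t - Complex.exp (-(ν * ‖ξ‖ ^ 2 * t : ℝ)))
      * ((ξ i : ℂ) * (ξ j : ℂ) / (‖ξ‖ ^ 2 : ℝ))

/-- `v = S(t) u`: the Fourier transform of `v` is the solution matrix at time `t` times the
Fourier transform of `u`. (Mathlib's Fourier variable is `η = ξ / 2π`.) -/
def IsSolutionAt (ν ν' κ : ℝ) {n s : ℕ} {r : ℝ} (t : ℝ) (u v : X n s r) : Prop :=
  (∀ᵐ η : Sp n, (𝓕 v.phi : L2 n) η =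
    S11 ν ν' κ t ((2 * Real.pi) • η) * (𝓕 u.phi : L2 n) η
      + ∑ j, S12 ν ν' κ t ((2 * Real.pi) • η) j * (𝓕 (u.mom j) : L2 n) η) ∧
  ∀ i : Fin n, ∀ᵐ η : Sp n, (𝓕 (v.mom i) : L2 n) η =
    S21 ν ν' κ t ((2 * Real.pi) • η) i * (𝓕 u.phi : L2 n) η
      + ∑ j, S22 ν ν' κ t ((2 * Real.pi) • η) i j * (𝓕 (u.mom j) : L2 n) η

/-- A `C⁰`-semigroup of bounded linear operators. -/
structure IsC0Semigroup {Y : Type*} [NormedAddCommGroup Y] [NormedSpace ℂ Y]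
    (S : ℝ≥0 → Y →L[ℂ] Y) : Prop where
  map_zero : S 0 = ContinuousLinearMap.id ℂ Y
  map_add : ∀ t₁ t₂ : ℝ≥0, S (t₁ + t₂) = (S t₁).comp (S t₂)
  tendsto_zero : ∀ y : Y, Tendsto (fun t => S t y) (𝓝 0) (𝓝 y)

/-- `w` is the value at `y` of the infinitesimal generator of `S`: the difference quotients
`(S(h) y - y) / h` converge to `w` as `h ↓ 0`. The generator's domain consists of the `y` for
which such a `w` exists. -/
def IsGeneratorAt {Y : Type*} [NormedAddCommGroup Y] [NormedSpace ℂ Y]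
    (S : ℝ≥0 → Y →L[ℂ] Y) (y w : Y) : Prop :=
  Tendsto (fun h : ℝ≥0 => ((h : ℝ)⁻¹ : ℂ) • (S h y - y)) (𝓝[>] 0) (𝓝 w)

end NSK

end

/-! On the Fourier side the system decouples into one linear ODE on `ℂ × ℂⁿ` per frequency `ξ`, with
generator `genSymbol`. Instead of verifying the semigroup law on the explicit matrix, the proof
works with `exp (t b(ξ))` for a suitable `b`, where that law is automatic, and identifies the matrix
with this exponential by uniqueness for ODEs.

The topology of `X` is absorbed first. If `w_k(ξ)² = ∑_{|α| ≤ k} |ξ^α|²`, then `f ↦ w_k f̂` is an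
isomorphism from `H^k_(∞)` onto `L²` of the high frequencies (`weightedFourierEquiv`). Hence `X`
becomes an `L²` space of vector-valued functions (`stateEquiv`), and `-A` becomes multiplication by
`wSymbol`, the symbol conjugated by the weights.

All four claims then follow from one uniform bound on `exp (t b(ξ))` for `t ≥ 0` and `|ξ| ≥ r`
(`exists_norm_exp_wSymbol_le`). Given that bound, dominated convergence yields strong continuity and
shows that the generator is multiplication by `b` on its maximal domain
(`isGeneratorAt_mulSemigroup_iff`). The domain is exactly the set of `u` with `Au ∈ X`, since
distributional derivatives also act by multiplication after Fourier transform (`isA_iff`).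

The bound has two sources. Both `λ±` are `-|ξ|²` times fixed numbers with positive real part, which
bounds the scalar coefficients uniformly, double root included (`exists_coef_bound`). Away from `ξ =
0`, `w_{k+1}` is comparable to `|ξ| w_k` (`exists_weight_comparison`); this matches the factors
`|ξ|^{∓1}` in the off-diagonal entries with the one-derivative gap between `φ` and `m`. -/

noncomputable section

namespace NSK

/-! ### Dominated convergence in `L²` -/

section DominatedConvergence

variable {Ω : Type*} [MeasurableSpace Ω] {μ : Measure Ω} {E : Type*} [NormedAddCommGroup E]

/-- Dominated convergence in `L²`. -/
theorem tendsto_Lp_two_of_dominated {ι : Type*} {l : Filter ι} [l.IsCountablyGenerated]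
    {u : ι → Lp E 2 μ} {v : Lp E 2 μ} {U : ι → Ω → E} {bound : Ω → ℝ} (hb : MemLp bound 2 μ)
    (huU : ∀ i, u i =ᵐ[μ] U i) (hbd : ∀ᶠ i in l, ∀ᵐ x ∂μ, ‖U i x - v x‖ ≤ bound x)
    (hlim : ∀ᵐ x ∂μ, Tendsto (fun i => U i x) l (𝓝 (v x))) :
    Tendsto u l (𝓝 v) := by
  rw [Lp.tendsto_Lp_iff_tendsto_eLpNorm']
  have h1 : ∀ i, eLpNorm (⇑(u i) - ⇑v) 2 μ
      = (∫⁻ x, ‖U i x - v x‖ₑ ^ (2 : ℝ) ∂μ) ^ (1 / 2 : ℝ) := fun i => by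
    have h : (⇑(u i) - ⇑v) =ᵐ[μ] fun x => U i x - v x := by
      filter_upwards [huU i] with x hx
      rw [Pi.sub_apply, hx]
    rw [eLpNorm_congr_ae h, eLpNorm_eq_lintegral_rpow_enorm_toReal (by simp) (by simp)]
    simp
  simp only [h1]
  have h2 : Tendsto (fun i => ∫⁻ x, ‖U i x - v x‖ₑ ^ (2 : ℝ) ∂μ) l (𝓝 (∫⁻ _, 0 ∂μ)) := by
    refine tendsto_lintegral_filter_of_dominated_convergence'
      (fun x => ‖bound x‖ₑ ^ (2 : ℝ)) ?_ ?_ ?_ ?_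
    · refine Eventually.of_forall fun i => ?_
      exact ((((Lp.aestronglyMeasurable (u i)).congr (huU i)).sub
        (Lp.aestronglyMeasurable v)).enorm).pow_const _
    · filter_upwards [hbd] with i hi
      filter_upwards [hi] with x hx
      gcongr
      rw [enorm_le_iff_norm_le]
      exact hx.trans (le_abs_self _)
    · have := hb.2
      rw [eLpNorm_lt_top_iff_lintegral_rpow_enorm_lt_top (by simp) (by simp)] at this
      simpa using this.ne
    · filter_upwards [hlim] with x hx
      have h3 : Tendsto (fun i => ‖U i x - v x‖ₑ) l (𝓝 0) := by
        have := (hx.sub_const (v x)).enorm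
        simpa using this
      have := (ENNReal.continuous_rpow_const (y := 2)).tendsto 0 |>.comp h3
      simpa [Function.comp_def] using this
  have := (ENNReal.continuous_rpow_const (y := (1 / 2 : ℝ))).tendsto _ |>.comp h2
  simpa [Function.comp_def] using this

end DominatedConvergence

/-! ### Multiplication operators with operator-valued symbols -/

section BoundedSymbol

variable {Ω : Type*} [MeasurableSpace Ω] {μ : Measure Ω} {E F : Type*}
  [NormedAddCommGroup E] [NormedSpace ℂ E] [NormedAddCommGroup F] [NormedSpace ℂ F]

/-- A measurable, essentially bounded operator-valued function. -/
structure IsBddSymbol (M : Ω → E →L[ℂ] F) (μ : Measure Ω) : Prop where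
  aesm : AEStronglyMeasurable M μ
  bdd : ∃ C : ℝ, ∀ᵐ x ∂μ, ‖M x‖ ≤ C

theorem aestronglyMeasurable_clm_apply {M : Ω → E →L[ℂ] F} {f : Ω → E}
    (hM : AEStronglyMeasurable M μ) (hf : AEStronglyMeasurable f μ) :
    AEStronglyMeasurable (fun x => M x (f x)) μ :=
  (ContinuousLinearMap.id ℂ (E →L[ℂ] F)).aestronglyMeasurable_comp₂ hM hf

theorem IsBddSymbol.memLp {M : Ω → E →L[ℂ] F} (hM : IsBddSymbol M μ) {f : Ω → E}
    (hf : MemLp f 2 μ) : MemLp (fun x => M x (f x)) 2 μ := by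
  obtain ⟨C, hC⟩ := hM.bdd
  refine hf.of_le_mul (c := C) (aestronglyMeasurable_clm_apply hM.aesm hf.1) ?_
  filter_upwards [hC] with x hx
  exact (M x).le_of_opNorm_le hx _

/-- Multiplication by a bounded operator-valued function, on `L²`. -/
def opMul (M : Ω → E →L[ℂ] F) (hM : IsBddSymbol M μ) : Lp E 2 μ →L[ℂ] Lp F 2 μ :=
  LinearMap.mkContinuousOfExistsBound
    { toFun := fun f => (hM.memLp (Lp.memLp f)).toLp _
      map_add' := fun f g => by
        rw [← MemLp.toLp_add]
        refine MemLp.toLp_congr _ _ ?_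
        filter_upwards [Lp.coeFn_add f g] with x hx
        simp only [hx, Pi.add_apply, map_add]
      map_smul' := fun c f => by
        rw [RingHom.id_apply, ← MemLp.toLp_const_smul]
        refine MemLp.toLp_congr _ _ ?_
        filter_upwards [Lp.coeFn_smul c f] with x hx
        simp only [hx, Pi.smul_apply, map_smul] } (by
    obtain ⟨C, hC⟩ := hM.bdd
    refine ⟨C, fun f => Lp.norm_le_mul_norm_of_ae_le_mul ?_⟩
    filter_upwards [hC, MemLp.coeFn_toLp (hM.memLp (Lp.memLp f))] with x hx h1
    simp only [LinearMap.coe_mk, AddHom.coe_mk]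
    rw [h1]
    exact (M x).le_of_opNorm_le hx _)

theorem coeFn_opMul (M : Ω → E →L[ℂ] F) (hM : IsBddSymbol M μ) (f : Lp E 2 μ) :
    opMul M hM f =ᵐ[μ] fun x => M x (f x) :=
  MemLp.coeFn_toLp (hM.memLp (Lp.memLp f))

theorem norm_opMul_le {M : Ω → E →L[ℂ] F} (hM : IsBddSymbol M μ) {C : ℝ}
    (hC : ∀ᵐ x ∂μ, ‖M x‖ ≤ C) (f : Lp E 2 μ) : ‖opMul M hM f‖ ≤ C * ‖f‖ := by
  refine Lp.norm_le_mul_norm_of_ae_le_mul ?_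
  filter_upwards [hC, coeFn_opMul M hM f] with x hx h1
  rw [h1]
  exact (M x).le_of_opNorm_le hx _

end BoundedSymbol

/-! ### Exponentials of bounded operators and linear ODEs -/

section OperatorExponential

variable {V : Type*} [NormedAddCommGroup V] [NormedSpace ℂ V] [CompleteSpace V]

theorem continuous_clm_exp : Continuous (NormedSpace.exp : (V →L[ℂ] V) → V →L[ℂ] V) :=
  let _ : NormedAlgebra ℚ (V →L[ℂ] V) := NormedAlgebra.restrictScalars ℚ ℂ _
  NormedSpace.exp_continuous

theorem clm_exp_add_smul (b : V →L[ℂ] V) (t s : ℝ) :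
    NormedSpace.exp ((t + s) • b) = NormedSpace.exp (t • b) * NormedSpace.exp (s • b) := by
  let _ : NormedAlgebra ℚ (V →L[ℂ] V) := NormedAlgebra.restrictScalars ℚ ℂ _
  rw [add_smul]
  exact NormedSpace.exp_add_of_commute (((Commute.refl b).smul_left t).smul_right s)

theorem hasDerivAt_clm_exp_apply (b : V →L[ℂ] V) (y : V) (t : ℝ) :
    HasDerivAt (fun t : ℝ => NormedSpace.exp (t • b) y) (NormedSpace.exp (t • b) (b y)) t := by
  have h := hasDerivAt_exp_smul_const b t
  exact (((ContinuousLinearMap.apply ℂ V y).restrictScalars ℝ).hasFDerivAt.comp_hasDerivAt t h)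

/-- The solutions of `y' = b y` are given by the exponential. -/
theorem eq_clm_exp_of_hasDerivAt (b : V →L[ℂ] V) (y : ℝ → V)
    (hy : ∀ t, HasDerivAt y (b (y t)) t) (t : ℝ) :
    y t = NormedSpace.exp (t • b) (y 0) := by
  refine congrFun (ODE_solution_unique_univ (v := fun _ => b) (s := fun _ => Set.univ)
    (t₀ := 0) (g := fun t : ℝ => NormedSpace.exp (t • b) (y 0))
    (fun _ => b.lipschitz.lipschitzOnWith) (fun t => ⟨hy t, trivial⟩) (fun t => ⟨?_, trivial⟩)
    (by simp)) t
  exact (((ContinuousLinearMap.apply ℂ V (y 0)).restrictScalars ℝ).hasFDerivAt.comp_hasDerivAt t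
    (hasDerivAt_exp_smul_const' b t))

end OperatorExponential

/-! ### Multiplication semigroups on `L²` and their generators -/

section Semigroup

variable {Ω : Type*} {V : Type*} [NormedAddCommGroup V] [NormedSpace ℂ V]

/-- The operator-valued function `x ↦ exp (t b(x))`. -/
def expSymbol (b : Ω → V →L[ℂ] V) (t : ℝ≥0) (x : Ω) : V →L[ℂ] V := NormedSpace.exp ((t : ℝ) • b x)

theorem expSymbol_zero {b : Ω → V →L[ℂ] V} (x : Ω) : expSymbol b 0 x = 1 := by
  simp [expSymbol]

variable [CompleteSpace V] {b : Ω → V →L[ℂ] V} {C : ℝ}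

theorem expSymbol_add (t s : ℝ≥0) (x : Ω) :
    expSymbol b (t + s) x = expSymbol b t x * expSymbol b s x := by
  simp only [expSymbol, NNReal.coe_add, clm_exp_add_smul]

theorem tendsto_coe_nhdsGT_zero :
    Tendsto (fun h : ℝ≥0 => (h : ℝ)) (𝓝[>] 0) (𝓝[>] 0) := by
  refine tendsto_nhdsWithin_iff.2 ⟨?_, ?_⟩
  · exact (NNReal.continuous_coe.tendsto 0).mono_left nhdsWithin_le_nhds
  · filter_upwards [self_mem_nhdsWithin] with h hh
    exact NNReal.coe_pos.2 hh

theorem tendsto_expSymbol_slope (x : Ω) (y : V) :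
    Tendsto (fun h : ℝ≥0 => ((h : ℝ)⁻¹ : ℂ) • (expSymbol b h x y - y)) (𝓝[>] 0) (𝓝 (b x y)) := by
  have h := (hasDerivAt_clm_exp_apply (b x) y 0).tendsto_slope_zero_right.comp
    tendsto_coe_nhdsGT_zero
  simp only [zero_smul, NormedSpace.exp_zero, zero_add] at h
  refine h.congr fun t => ?_
  simp only [Function.comp_apply, expSymbol, ← Complex.ofReal_inv, Complex.coe_smul]
  rfl

/-- Mean value inequality: the derivative of the orbit is `exp (t b) (b y)`, of norm at most `C ‖b
y‖`. After division by `h` this dominates the difference quotients independently of `h`. -/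
theorem norm_expSymbol_sub_le {x : Ω} (hx : ∀ t : ℝ≥0, ‖expSymbol b t x‖ ≤ C) (y : V) (h : ℝ≥0) :
    ‖expSymbol b h x y - y‖ ≤ C * ‖b x y‖ * h := by
  have := norm_image_sub_le_of_norm_deriv_le_segment' (a := (0 : ℝ)) (b := h)
    (f := fun t : ℝ => NormedSpace.exp (t • b x) y) (C := C * ‖b x y‖)
    (fun t _ => (hasDerivAt_clm_exp_apply (b x) y t).hasDerivWithinAt)
    (fun t ht => ContinuousLinearMap.le_of_opNorm_le _ (hx ⟨t, ht.1⟩) _) h ⟨h.2, le_rfl⟩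
  simpa [expSymbol] using this

variable [MeasurableSpace Ω] {μ : Measure Ω}

/-- A measurable operator-valued function whose exponentials are bounded for positive times. -/
structure IsStableSymbol (b : Ω → V →L[ℂ] V) (μ : Measure Ω) (C : ℝ) : Prop where
  aesm : AEStronglyMeasurable b μ
  bdd : ∀ᵐ x ∂μ, ∀ t : ℝ≥0, ‖expSymbol b t x‖ ≤ C

theorem IsStableSymbol.isBddSymbol (hb : IsStableSymbol b μ C) (t : ℝ≥0) :
    IsBddSymbol (expSymbol b t) μ where
  aesm := continuous_clm_exp.comp_aestronglyMeasurable (hb.aesm.const_smul (t : ℝ))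
  bdd := ⟨C, hb.bdd.mono fun _ hx => hx t⟩

/-- The multiplication semigroup generated by multiplication with `b`. -/
def mulSemigroup (hb : IsStableSymbol b μ C) (t : ℝ≥0) : Lp V 2 μ →L[ℂ] Lp V 2 μ :=
  opMul (expSymbol b t) (hb.isBddSymbol t)

theorem coeFn_mulSemigroup (hb : IsStableSymbol b μ C) (t : ℝ≥0) (f : Lp V 2 μ) :
    mulSemigroup hb t f =ᵐ[μ] fun x => expSymbol b t x (f x) :=
  coeFn_opMul _ _ f

theorem norm_mulSemigroup_le (hb : IsStableSymbol b μ C) (t : ℝ≥0) (f : Lp V 2 μ) :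
    ‖mulSemigroup hb t f‖ ≤ C * ‖f‖ :=
  norm_opMul_le _ (hb.bdd.mono fun _ hx => hx t) f

/-- Dominated convergence: the integrand is continuous in time at each point, and two values of an
orbit differ by at most `2C ‖f x‖`. -/
theorem continuous_mulSemigroup_apply (hb : IsStableSymbol b μ C) (f : Lp V 2 μ) :
    Continuous fun t => mulSemigroup hb t f := by
  refine continuous_iff_continuousAt.2 fun t => ?_
  refine tendsto_Lp_two_of_dominated (bound := fun x => (2 * C) * ‖f x‖)
    ((Lp.memLp f).norm.const_mul _) (fun s => coeFn_mulSemigroup hb s f) ?_ ?_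
  · refine Eventually.of_forall fun s => ?_
    filter_upwards [hb.bdd, coeFn_mulSemigroup hb t f] with x hx h1
    rw [h1]
    refine (norm_sub_le _ _).trans ?_
    linarith [(expSymbol b s x).le_of_opNorm_le (hx s) (f x),
      (expSymbol b t x).le_of_opNorm_le (hx t) (f x)]
  · filter_upwards [coeFn_mulSemigroup hb t f] with x h1
    rw [h1]
    have : Continuous fun s : ℝ≥0 => expSymbol b s x (f x) :=
      ((continuous_clm_exp (V := V)).comp
        (NNReal.continuous_coe.smul continuous_const)).clm_apply continuous_const
    exact this.tendsto t

theorem isC0Semigroup_mulSemigroup (hb : IsStableSymbol b μ C) :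
    IsC0Semigroup (mulSemigroup hb) where
  map_zero := by
    ext1 f
    refine Lp.ext ?_
    filter_upwards [coeFn_mulSemigroup hb 0 f] with x hx
    rw [hx, expSymbol_zero]
    rfl
  map_add t s := by
    ext1 f
    refine Lp.ext ?_
    filter_upwards [coeFn_mulSemigroup hb (t + s) f, coeFn_mulSemigroup hb s f,
      coeFn_mulSemigroup hb t (mulSemigroup hb s f)] with x h1 h2 h3
    rw [h1, ContinuousLinearMap.comp_apply, h3, h2, expSymbol_add]
    rfl
  tendsto_zero f := by
    have h := (continuous_mulSemigroup_apply hb f).tendsto 0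
    have h0 : mulSemigroup hb 0 f = f := by
      refine Lp.ext ?_
      filter_upwards [coeFn_mulSemigroup hb 0 f] with x hx
      rw [hx, expSymbol_zero]
      rfl
    rwa [h0] at h

theorem coeFn_slope (hb : IsStableSymbol b μ C) (f : Lp V 2 μ) (h : ℝ≥0) :
    (((h : ℝ)⁻¹ : ℂ) • (mulSemigroup hb h f - f) : Lp V 2 μ) =ᵐ[μ]
      fun x => ((h : ℝ)⁻¹ : ℂ) • (expSymbol b h x (f x) - f x) := by
  filter_upwards [Lp.coeFn_smul ((h : ℝ)⁻¹ : ℂ) (mulSemigroup hb h f - f),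
    Lp.coeFn_sub (mulSemigroup hb h f) f, coeFn_mulSemigroup hb h f] with x h1 h2 h3
  rw [h1, Pi.smul_apply, h2, Pi.sub_apply, h3]

/-- The generator of the multiplication semigroup is multiplication by `b` on its maximal
domain. -/
theorem isGeneratorAt_mulSemigroup_iff (hb : IsStableSymbol b μ C) (f w : Lp V 2 μ) :
    IsGeneratorAt (mulSemigroup hb) f w ↔ ∀ᵐ x ∂μ, w x = b x (f x) := by
  constructor
  · intro hw
    -- Convergence in `L²` gives almost everywhere convergence along a sequence tending to `0⁺`; the
    -- pointwise limit of the quotients is already known to be `b f`.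
    obtain ⟨ns, hns, hae⟩ := (tendstoInMeasure_of_tendsto_Lp hw).exists_seq_tendsto_ae'
    have h1 := ae_all_iff.2 fun i : ℕ => coeFn_slope hb f (ns i)
    filter_upwards [hae, h1] with x hx h1x
    refine tendsto_nhds_unique hx ?_
    simp only [h1x]
    exact (tendsto_expSymbol_slope x (f x)).comp hns
  · intro hw
    -- The quotients contribute `C ‖w x‖`, because `b f = w` is in `L²`, and the limit itself
    -- contributes the remaining `‖w x‖`.
    refine tendsto_Lp_two_of_dominated (bound := fun x => (C + 1) * ‖w x‖)
      ((Lp.memLp w).norm.const_mul _) (fun h => coeFn_slope hb f h) ?_ ?_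
    · filter_upwards [self_mem_nhdsWithin] with h hh
      have hpos : (0 : ℝ) < h := NNReal.coe_pos.2 hh
      filter_upwards [hb.bdd, hw] with x hx hwx
      refine (norm_sub_le _ _).trans ?_
      have h2 := norm_expSymbol_sub_le hx (f x) h
      rw [← hwx] at h2
      have h3 : ‖((h : ℝ)⁻¹ : ℂ) • (expSymbol b h x (f x) - f x)‖ ≤ C * ‖w x‖ := by
        rw [norm_smul, norm_inv, Complex.norm_real, Real.norm_of_nonneg hpos.le,
          inv_mul_le_iff₀ hpos]
        linarith
      linarith
    · filter_upwards [hw] with x hwx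
      rw [hwx]
      exact tendsto_expSymbol_slope x (f x)

end Semigroup

/-! ### Transport of semigroups along isomorphisms; joint continuity -/

section Transport

variable {Y Z : Type*} [NormedAddCommGroup Y] [NormedSpace ℂ Y] [NormedAddCommGroup Z]
  [NormedSpace ℂ Z]

/-- A family of operators, transported along an isomorphism. -/
def conjFamily (J : Y ≃L[ℂ] Z) (T : ℝ≥0 → Z →L[ℂ] Z) (t : ℝ≥0) : Y →L[ℂ] Y :=
  (J.symm : Z →L[ℂ] Y).comp ((T t).comp (J : Y →L[ℂ] Z))

variable (J : Y ≃L[ℂ] Z) {T : ℝ≥0 → Z →L[ℂ] Z}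

theorem conjFamily_apply (t : ℝ≥0) (y : Y) : conjFamily J T t y = J.symm (T t (J y)) := rfl

theorem IsC0Semigroup.conj (hT : IsC0Semigroup T) : IsC0Semigroup (conjFamily J T) where
  map_zero := by
    ext1 y
    simp [conjFamily_apply, hT.map_zero]
  map_add t s := by
    ext1 y
    simp [conjFamily_apply, hT.map_add]
  tendsto_zero y := by
    have h := (J.symm.continuous.tendsto _).comp (hT.tendsto_zero (J y))
    simpa [Function.comp_def, conjFamily_apply] using h

theorem isGeneratorAt_conj_iff (y w : Y) :
    IsGeneratorAt (conjFamily J T) y w ↔ IsGeneratorAt T (J y) (J w) := by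
  unfold IsGeneratorAt
  rw [J.toHomeomorph.isInducing.tendsto_nhds_iff]
  refine tendsto_congr fun h => ?_
  simp [conjFamily_apply]

theorem exists_norm_conjFamily_le {C : ℝ} (hC : ∀ t z, ‖T t z‖ ≤ C * ‖z‖) :
    ∃ C' : ℝ, 0 < C' ∧ ∀ t y, ‖conjFamily J T t y‖ ≤ C' * ‖y‖ := by
  set a := ‖(J.symm : Z →L[ℂ] Y)‖
  set c := ‖(J : Y →L[ℂ] Z)‖
  -- The summand `1` makes the constant strictly positive; `|C|` is needed because the sign of `C`
  -- is not known.
  refine ⟨a * (|C| * c) + 1, by positivity, fun t y => ?_⟩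
  have h1 := (J.symm : Z →L[ℂ] Y).le_opNorm (T t (J y))
  have h2 := (J : Y →L[ℂ] Z).le_opNorm y
  calc ‖conjFamily J T t y‖ ≤ a * ‖T t (J y)‖ := h1
    _ ≤ a * (|C| * (c * ‖y‖)) := by
      gcongr
      refine (hC t _).trans ?_
      gcongr
      · exact le_abs_self C
      · exact h2
    _ ≤ (a * (|C| * c) + 1) * ‖y‖ := by nlinarith [norm_nonneg y]

/-- A bounded, strongly continuous family of operators is jointly continuous. -/
theorem continuousOn_apply_of_bounded {S : ℝ≥0 → Y →L[ℂ] Y} {C : ℝ}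
    (hC : ∀ t y, ‖S t y‖ ≤ C * ‖y‖) (hS : ∀ y, Continuous fun t => S t y) {I : Set ℝ≥0}
    {u : ℝ≥0 → Y} (hu : ContinuousOn u I) : ContinuousOn (fun t => S t (u t)) I := by
  intro t ht
  have h1 : Tendsto (fun s => C * ‖u s - u t‖) (𝓝[I] t) (𝓝 0) := by
    have := ((hu t ht).sub_const (u t)).norm.const_mul C
    simpa using this
  have h2 : Tendsto (fun s => S s (u s - u t)) (𝓝[I] t) (𝓝 0) :=
    squeeze_zero_norm (fun s => hC s _) h1
  -- Split `S_s u(s) = S_s (u(s) - u(t)) + S_s u(t)`: the uniform bound controls the first term,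
  -- strong continuity the second.
  have h3 := h2.add (((hS (u t)).tendsto t).mono_left nhdsWithin_le_nhds)
  simpa [ContinuousWithinAt] using h3

end Transport

/-! ### Tempered distributions whose Fourier transform is a function -/

section FourierSymbol

variable {n : ℕ}

/-- The tempered distribution `T` has Fourier transform the function `h`. -/
structure HasFourier (T : 𝓢'(Sp n, ℂ)) (h : Sp n → ℂ) : Prop where
  locInt : LocallyIntegrable h
  integrable : ∀ φ : 𝓢(Sp n, ℂ), Integrable fun η => φ η * h η
  apply_eq : ∀ φ : 𝓢(Sp n, ℂ), 𝓕 T φ = ∫ η, φ η * h η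

theorem locallyIntegrable_coeFn (f : L2 n) : LocallyIntegrable (fun η => f η) := by
  have h : MemLp (fun η => f η) 2 (volume : Measure (Sp n)) := Lp.memLp f
  have h12 : (1 : ℝ≥0∞) ≤ 2 := one_le_two
  exact MemLp.locallyIntegrable h h12

theorem integrable_schwartz_mul (f : L2 n) (φ : 𝓢(Sp n, ℂ)) :
    Integrable fun η => φ η * f η :=
  (φ.memLp 2).integrable_mul (Lp.memLp f)

theorem hasFourier_of_fourier_eq {T : 𝓢'(Sp n, ℂ)} (f : L2 n) (hT : 𝓕 T = toDistr f) :
    HasFourier T (fun η => f η) := by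
  refine ⟨locallyIntegrable_coeFn f, integrable_schwartz_mul f, fun φ => ?_⟩
  rw [hT]
  exact Lp.toTemperedDistribution_apply f φ

theorem hasFourier_toDistr (f : L2 n) :
    HasFourier (toDistr f) (fun η => (𝓕 f : L2 n) η) :=
  hasFourier_of_fourier_eq _ (Lp.fourier_toTemperedDistribution_eq f)

theorem toDistr_zero : toDistr (0 : L2 n) = 0 :=
  map_zero (Lp.toTemperedDistributionCLM ℂ volume 2)

theorem HasFourier.congr {T : 𝓢'(Sp n, ℂ)} {h h' : Sp n → ℂ} (hT : HasFourier T h)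
    (hh : h = h') : HasFourier T h' := hh ▸ hT

/-- Smooth compactly supported functions are Schwartz functions, and they suffice to separate
locally integrable functions. -/
theorem HasFourier.ae_eq {T : 𝓢'(Sp n, ℂ)} {h h' : Sp n → ℂ} (hT : HasFourier T h)
    (hT' : HasFourier T h') : h =ᵐ[volume] h' := by
  refine ae_eq_of_integral_contDiff_smul_eq hT.locInt hT'.locInt fun g g_smooth g_cpt => ?_
  have hg₁ : HasCompactSupport (Complex.ofRealCLM ∘ g) := g_cpt.comp_left rfl
  have hg₂ : ContDiff ℝ ((⊤ : ℕ∞) : WithTop ℕ∞) (Complex.ofRealCLM ∘ g) := by fun_prop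
  have h1 := hT.apply_eq (hg₁.toSchwartzMap hg₂)
  have h2 := hT'.apply_eq (hg₁.toSchwartzMap hg₂)
  rw [h1] at h2
  simpa using h2

theorem HasFourier.eq_of_ae_eq {T T' : 𝓢'(Sp n, ℂ)} {h h' : Sp n → ℂ} (hT : HasFourier T h)
    (hT' : HasFourier T' h') (hh : h =ᵐ[volume] h') : T = T' := by
  have h1 : 𝓕 T = 𝓕 T' := by
    ext φ
    rw [hT.apply_eq, hT'.apply_eq]
    refine integral_congr_ae ?_
    filter_upwards [hh] with x hx
    rw [hx]
  have h2 := congrArg (fun S : 𝓢'(Sp n, ℂ) => (𝓕⁻ S : 𝓢'(Sp n, ℂ))) h1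
  simpa only [FourierTransform.fourierInv_fourier_eq] using h2

/-- The bridge from distributional identities to almost everywhere identities of functions; both the
jet condition defining `H` and the relation `IsA` are translated through it. -/
theorem HasFourier.toDistr_eq_iff {T : 𝓢'(Sp n, ℂ)} {h : Sp n → ℂ} (hT : HasFourier T h)
    (f : L2 n) : toDistr f = T ↔ (𝓕 f : L2 n) =ᵐ[volume] h :=
  ⟨fun hf => (hf ▸ hasFourier_toDistr f).ae_eq hT,
    fun hf => (hasFourier_toDistr f).eq_of_ae_eq hT hf⟩

theorem HasFourier.add {T T' : 𝓢'(Sp n, ℂ)} {h h' : Sp n → ℂ} (hT : HasFourier T h)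
    (hT' : HasFourier T' h') : HasFourier (T + T') (fun η => h η + h' η) where
  locInt := hT.locInt.add hT'.locInt
  integrable φ := by
    simp only [mul_add]
    exact (hT.integrable φ).add (hT'.integrable φ)
  apply_eq φ := by
    simp only [mul_add, integral_add (hT.integrable φ) (hT'.integrable φ), ← hT.apply_eq,
      ← hT'.apply_eq]
    rw [FourierAdd.fourier_add]
    rfl

theorem HasFourier.smul {T : 𝓢'(Sp n, ℂ)} {h : Sp n → ℂ} (hT : HasFourier T h) (c : ℂ) :
    HasFourier (c • T) (fun η => c * h η) where
  locInt := hT.locInt.smul c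
  integrable φ := by
    simpa only [mul_left_comm] using (hT.integrable φ).const_mul c
  apply_eq φ := by
    simp only [mul_left_comm _ c, integral_const_mul, ← hT.apply_eq]
    rw [FourierSMul.fourier_smul]
    rfl

theorem hasFourier_zero : HasFourier (0 : 𝓢'(Sp n, ℂ)) (fun _ => 0) :=
 by
  have h := (hasFourier_toDistr (0 : L2 n)).smul 0
  rw [toDistr_zero, zero_smul ℂ (0 : 𝓢'(Sp n, ℂ))] at h
  simpa only [zero_mul] using h

theorem hasFourier_sum {ι : Type*} (s : Finset ι) {T : ι → 𝓢'(Sp n, ℂ)} {h : ι → Sp n → ℂ}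
    (hT : ∀ i, HasFourier (T i) (h i)) :
    HasFourier (∑ i ∈ s, T i) (fun η => ∑ i ∈ s, h i η) := by
  classical
  induction s using Finset.induction_on with
  | empty => simpa using hasFourier_zero
  | insert i s hi ih =>
    simp only [Finset.sum_insert hi]
    exact (hT i).add ih

theorem HasFourier.lineDeriv {T : 𝓢'(Sp n, ℂ)} {h : Sp n → ℂ} (hT : HasFourier T h) (j : Fin n) :
    HasFourier (∂_{(e j : Sp n)} T)
      (fun η => Complex.I * (((2 * Real.pi) • η) j : ℝ) * h η) := by
  have htg : (fun η : Sp n => ((inner ℝ η (e j) : ℝ) : ℂ)).HasTemperateGrowth := by fun_prop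
  have htg' : (fun η : Sp n => (inner ℝ η (e j) : ℝ)).HasTemperateGrowth := by fun_prop
  -- The polynomial factor can sit on `h` or on the test function, which stays Schwartz. This gives
  -- integrability against `φ` as well as the formula.
  have hval : ∀ (φ : 𝓢(Sp n, ℂ)) (η : Sp n),
      (2 * Real.pi * Complex.I) * ((SchwartzMap.smulLeftCLM ℂ
        (fun η : Sp n => ((inner ℝ η (e j) : ℝ) : ℂ)) φ) η * h η) =
      φ η * (Complex.I * (((2 * Real.pi) • η) j : ℝ) * h η) := by
    intro φ η
    rw [SchwartzMap.smulLeftCLM_apply_apply htg]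
    simp [e, EuclideanSpace.inner_single_right]
    ring
  refine ⟨?_, fun φ => ?_, fun φ => ?_⟩
  · have hc : Continuous fun η : Sp n => Complex.I * (((2 * Real.pi) • η) j : ℝ) := by fun_prop
    exact hT.locInt.continuous_mul hc
  · simp only [← hval]
    exact (hT.integrable _).const_mul _
  · simp only [← hval, integral_const_mul]
    rw [TemperedDistribution.fourier_lineDerivOp_eq, ← hT.apply_eq]
    rfl

theorem HasFourier.neg {T : 𝓢'(Sp n, ℂ)} {h : Sp n → ℂ} (hT : HasFourier T h) :
    HasFourier (-T) (fun η => -h η) := by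
  have h := hT.smul (-1)
  rw [neg_one_smul ℂ T] at h
  simpa only [neg_mul, one_mul] using h

theorem HasFourier.sub {T T' : 𝓢'(Sp n, ℂ)} {h h' : Sp n → ℂ} (hT : HasFourier T h)
    (hT' : HasFourier T' h') : HasFourier (T - T') (fun η => h η - h' η) := by
  simpa only [sub_eq_add_neg] using hT.add hT'.neg

theorem HasFourier.iterate_lineDeriv {T : 𝓢'(Sp n, ℂ)} {h : Sp n → ℂ} (hT : HasFourier T h)
    (j : Fin n) (k : ℕ) :
    HasFourier (((LineDeriv.lineDerivOpCLM ℂ 𝓢'(Sp n, ℂ) (e j : Sp n)) ^ k) T)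
      (fun η => (Complex.I * (((2 * Real.pi) • η) j : ℝ)) ^ k * h η) := by
  induction k with
  | zero => simpa using hT
  | succ k ih =>
    rw [pow_succ']
    refine (ih.lineDeriv j).congr ?_
    ext η
    ring

theorem HasFourier.multiDeriv {T : 𝓢'(Sp n, ℂ)} {h : Sp n → ℂ} (hT : HasFourier T h)
    (α : Fin n → ℕ) :
    HasFourier (multiDeriv α T)
      (fun η => (∏ j, (Complex.I * (((2 * Real.pi) • η) j : ℝ)) ^ α j) * h η) := by
  have key : ∀ l : List (Fin n), HasFourier
      ((l.map fun j => (LineDeriv.lineDerivOpCLM ℂ 𝓢'(Sp n, ℂ) (e j : Sp n)) ^ α j).prod T)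
      (fun η => (l.map fun j => (Complex.I * (((2 * Real.pi) • η) j : ℝ)) ^ α j).prod * h η) := by
    intro l
    induction l with
    | nil => simpa using hT
    | cons j l ih =>
      simp only [List.map_cons, List.prod_cons]
      refine (ih.iterate_lineDeriv j (α j)).congr ?_
      ext η
      ring
  refine (key (List.finRange n)).congr ?_
  ext η
  rw [Fin.prod_univ_def]

theorem HasFourier.laplacian {T : 𝓢'(Sp n, ℂ)} {h : Sp n → ℂ} (hT : HasFourier T h) :
    HasFourier (Δ T) (fun η => -(‖(2 * Real.pi) • η‖ ^ 2 : ℝ) * h η) := by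
  rw [TemperedDistribution.laplacian_eq_sum (EuclideanSpace.basisFun (Fin n) ℝ)]
  have h1 : ∀ j, HasFourier (∂_{EuclideanSpace.basisFun (Fin n) ℝ j}
      (∂_{EuclideanSpace.basisFun (Fin n) ℝ j} T)) _ := fun j => by
    rw [EuclideanSpace.basisFun_apply]
    exact (hT.lineDeriv j).lineDeriv j
  refine (hasFourier_sum Finset.univ h1).congr ?_
  ext η
  rw [EuclideanSpace.norm_sq_eq]
  push_cast
  rw [← Finset.sum_neg_distrib, Finset.sum_mul]
  refine Finset.sum_congr rfl fun j _ => ?_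
  rw [← Complex.ofReal_pow, Real.norm_eq_abs, sq_abs]
  push_cast
  linear_combination ((((2 * Real.pi) • η) j : ℝ) : ℂ) ^ 2 * h η * Complex.I_sq

theorem hasFourier_divergence {m : Fin n → 𝓢'(Sp n, ℂ)} {h : Fin n → Sp n → ℂ}
    (hm : ∀ j, HasFourier (m j) (h j)) :
    HasFourier (divergence m)
      (fun η => ∑ j, Complex.I * (((2 * Real.pi) • η) j : ℝ) * h j η) :=
  hasFourier_sum Finset.univ fun j => (hm j).lineDeriv j

end FourierSymbol

/-! ### The scalar coefficient functions: derivatives and uniform bounds -/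

section Coefficients

theorem hasDerivAt_cexp_mul_ofReal (a : ℂ) (t : ℝ) :
    HasDerivAt (fun t : ℝ => Complex.exp (a * t)) (a * Complex.exp (a * t)) t := by
  have h1 : HasDerivAt (fun t : ℝ => a * (t : ℂ)) a t := by
    simpa using (Complex.ofRealCLM.hasDerivAt (x := t)).const_mul a
  simpa [mul_comm] using h1.cexp

theorem hasDerivAt_coefA (a b : ℂ) (t : ℝ) :
    HasDerivAt (coefA a b) (-(a * b) * coefB a b t) t := by
  have ht : HasDerivAt (fun t : ℝ => (t : ℂ)) 1 t := Complex.ofRealCLM.hasDerivAt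
  by_cases hab : a = b
  · have h := ((ht.const_mul a).const_sub 1).mul (hasDerivAt_cexp_mul_ofReal a t)
    have he : coefA a b = fun t : ℝ => (1 - a * t) * Complex.exp (a * t) := by
      ext t; simp [coefA, hab]
    rw [he]
    refine h.congr_deriv ?_
    simp only [coefB, hab, if_true]
    ring
  · have h := (((hasDerivAt_cexp_mul_ofReal b t).const_mul a).sub
      ((hasDerivAt_cexp_mul_ofReal a t).const_mul b)).div_const (a - b)
    have he : coefA a b = fun t : ℝ =>
        (a * Complex.exp (b * t) - b * Complex.exp (a * t)) / (a - b) := by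
      ext t; simp [coefA, hab]
    rw [he]
    refine h.congr_deriv ?_
    simp only [coefB, hab, if_false]
    ring

theorem hasDerivAt_coefB (a b : ℂ) (t : ℝ) :
    HasDerivAt (coefB a b) (coefC a b t) t := by
  have ht : HasDerivAt (fun t : ℝ => (t : ℂ)) 1 t := Complex.ofRealCLM.hasDerivAt
  by_cases hab : a = b
  · have h := ht.mul (hasDerivAt_cexp_mul_ofReal a t)
    have he : coefB a b = fun t : ℝ => t * Complex.exp (a * t) := by
      ext t; simp [coefB, hab]
    rw [he]
    refine h.congr_deriv ?_
    simp only [coefC, hab, if_true]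
    ring
  · have h := ((hasDerivAt_cexp_mul_ofReal a t).sub
      (hasDerivAt_cexp_mul_ofReal b t)).div_const (a - b)
    have he : coefB a b = fun t : ℝ => (Complex.exp (a * t) - Complex.exp (b * t)) / (a - b) := by
      ext t; simp [coefB, hab]
    rw [he]
    refine h.congr_deriv ?_
    simp only [coefC, hab, if_false]

/-- This linear relation also holds at a double root, so `coefC` can be differentiated without
splitting cases again. -/
theorem coefC_eq (a b : ℂ) (t : ℝ) : coefC a b t = coefA a b t + (a + b) * coefB a b t := by
  by_cases hab : a = b
  · simp only [coefA, coefB, coefC, hab, if_true]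
    ring
  · have : a - b ≠ 0 := sub_ne_zero.2 hab
    simp only [coefA, coefB, coefC, hab, if_false]
    field_simp
    ring

theorem hasDerivAt_coefC (a b : ℂ) (t : ℝ) :
    HasDerivAt (coefC a b) ((a + b) * coefC a b t - a * b * coefB a b t) t := by
  have he : coefC a b = fun t => coefA a b t + (a + b) * coefB a b t := funext (coefC_eq a b)
  have h := (hasDerivAt_coefA a b t).add ((hasDerivAt_coefB a b t).const_mul (a + b))
  rw [he]
  refine h.congr_deriv ?_
  simp only [← coefC_eq]
  ring

theorem coefA_zero (a b : ℂ) : coefA a b 0 = 1 := by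
  by_cases hab : a = b
  · simp [coefA, hab]
  · simp [coefA, hab, sub_ne_zero.2 hab]

theorem coefB_zero (a b : ℂ) : coefB a b 0 = 0 := by
  simp [coefB]

theorem coefC_zero (a b : ℂ) : coefC a b 0 = 1 := by
  simp [coefC_eq, coefA_zero, coefB_zero]

theorem norm_cexp_neg_mul_le_one {p : ℂ} (hp : 0 < p.re) {ρ t : ℝ} (hρ : 0 ≤ ρ) (ht : 0 ≤ t) :
    ‖Complex.exp (-(ρ * p) * t)‖ ≤ 1 := by
  rw [Complex.norm_exp, Real.exp_le_one_iff]
  have : (-(ρ * p) * t).re = -(ρ * p.re * t) := by simp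
  rw [this]
  have : 0 ≤ ρ * p.re * t := by positivity
  linarith

/-- From `1 + y ≤ e^y` with `y = (Re p) ρ t`. It absorbs the factor linear in `t` that appears at a
double root. -/
theorem mul_norm_cexp_neg_mul_le {p : ℂ} (hp : 0 < p.re) (ρ t : ℝ) :
    ρ * t * ‖Complex.exp (-(ρ * p) * t)‖ ≤ 1 / p.re := by
  have h1 : (-(ρ * p) * t).re = -(p.re * (ρ * t)) := by simp; ring
  rw [Complex.norm_exp, h1, Real.exp_neg, ← div_eq_mul_inv, div_le_div_iff₀ (Real.exp_pos _) hp,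
    one_mul]
  linarith [Real.add_one_le_exp (p.re * (ρ * t))]

/-- For roots `-ρ p`, `-ρ q` in the left half plane, the coefficient functions are bounded
uniformly in `t ≥ 0` and in the scale `ρ > 0`. -/
theorem exists_coef_bound {p q : ℂ} (hp : 0 < p.re) (hq : 0 < q.re) :
    ∃ C : ℝ, 0 ≤ C ∧ ∀ ρ t : ℝ, 0 < ρ → 0 ≤ t →
      ‖coefA (-(ρ * p)) (-(ρ * q)) t‖ ≤ C ∧ ρ * ‖coefB (-(ρ * p)) (-(ρ * q)) t‖ ≤ C ∧
      ‖coefC (-(ρ * p)) (-(ρ * q)) t‖ ≤ C := by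
  by_cases hpq : p = q
  · subst hpq
    -- Double root: `(1 ± ρtp) e^{-ρpt}` costs `1 + ‖p‖ / Re p`, and `ρt e^{-ρpt}` costs `1 / Re p`;
    -- the constant dominates both.
    refine ⟨1 + (1 + ‖p‖) * (1 / p.re), by positivity, fun ρ t hρ ht => ?_⟩
    have h0 := norm_cexp_neg_mul_le_one hp hρ.le ht
    have h1 := mul_norm_cexp_neg_mul_le hp ρ t
    have h3 : 0 ≤ 1 / p.re := by positivity
    have h4 : 0 ≤ ‖p‖ * (1 / p.re) := by positivity
    have key : ∀ z : ℂ, ‖z‖ = ρ * t * ‖p‖ →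
        ‖(1 + z) * Complex.exp (-(ρ * p) * t)‖ ≤ 1 + (1 + ‖p‖) * (1 / p.re) := by
      intro z hz
      rw [norm_mul]
      calc ‖1 + z‖ * ‖Complex.exp (-(ρ * p) * t)‖
          ≤ (1 + ρ * t * ‖p‖) * ‖Complex.exp (-(ρ * p) * t)‖ := by
            gcongr
            refine (norm_add_le _ _).trans ?_
            rw [norm_one, hz]
        _ = ‖Complex.exp (-(ρ * p) * t)‖ + ‖p‖ * (ρ * t * ‖Complex.exp (-(ρ * p) * t)‖) := by
            ring
        _ ≤ 1 + ‖p‖ * (1 / p.re) := by gcongr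
        _ ≤ _ := by linarith
    have hn : ‖-(ρ * p) * (t : ℂ)‖ = ρ * t * ‖p‖ := by
      rw [norm_mul, norm_neg, norm_mul, Complex.norm_real, Complex.norm_real,
        Real.norm_of_nonneg hρ.le, Real.norm_of_nonneg ht]
      ring
    simp only [coefA, coefB, coefC, if_true]
    refine ⟨?_, ?_, key _ hn⟩
    · rw [sub_eq_add_neg]
      exact key _ (by rw [norm_neg, hn])
    · rw [norm_mul, Complex.norm_real, Real.norm_of_nonneg ht, ← mul_assoc]
      linarith
  · have hd : 0 < ‖p - q‖ := norm_pos_iff.2 (sub_ne_zero.2 hpq)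
    -- Distinct roots: all exponentials have norm at most `1`, and `ρ` cancels between numerator and
    -- denominator. The `‖p‖ + ‖q‖` serves `coefA` and `coefC`, the `2` serves `coefB`.
    refine ⟨(‖p‖ + ‖q‖ + 2) / ‖p - q‖, by positivity, fun ρ t hρ ht => ?_⟩
    have ha := norm_cexp_neg_mul_le_one hp hρ.le ht
    have hb := norm_cexp_neg_mul_le_one hq hρ.le ht
    have hρc : (ρ : ℂ) ≠ 0 := Complex.ofReal_ne_zero.2 hρ.ne'
    have hne : ¬ (-(ρ * p) = -(ρ * q)) := fun h =>
      hpq (mul_left_cancel₀ hρc (neg_injective h))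
    have hnr : ‖-((ρ : ℂ) * p) - -(ρ * q)‖ = ρ * ‖p - q‖ := by
      rw [show -((ρ : ℂ) * p) - -(ρ * q) = -(ρ * (p - q)) by ring, norm_neg, norm_mul,
        Complex.norm_real, Real.norm_of_nonneg hρ.le]
    have hnp : ‖-((ρ : ℂ) * p)‖ = ρ * ‖p‖ := by
      rw [norm_neg, norm_mul, Complex.norm_real, Real.norm_of_nonneg hρ.le]
    have hnq : ‖-((ρ : ℂ) * q)‖ = ρ * ‖q‖ := by
      rw [norm_neg, norm_mul, Complex.norm_real, Real.norm_of_nonneg hρ.le]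
    have key : ∀ x y : ℂ, ‖x‖ ≤ 1 → ‖y‖ ≤ 1 →
        ‖(-(ρ * p) * x - -(ρ * q) * y) / (-(ρ * p) - -(ρ * q))‖
          ≤ (‖p‖ + ‖q‖ + 2) / ‖p - q‖ := by
      intro x y hx hy
      rw [norm_div, hnr, div_le_div_iff₀ (by positivity) hd]
      have h1 : ‖-(ρ * p) * x - -(ρ * q) * y‖ ≤ ρ * ‖p‖ + ρ * ‖q‖ := by
        refine (norm_sub_le _ _).trans ?_
        rw [norm_mul, norm_mul, hnp, hnq]
        exact add_le_add (mul_le_of_le_one_right (by positivity) hx)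
          (mul_le_of_le_one_right (by positivity) hy)
      calc _ ≤ (ρ * ‖p‖ + ρ * ‖q‖) * ‖p - q‖ := by gcongr
        _ ≤ _ := by
          have : 0 ≤ ρ * ‖p - q‖ := by positivity
          linarith
    simp only [coefA, coefB, coefC, if_neg hne]
    refine ⟨key _ _ hb ha, ?_, key _ _ ha hb⟩
    rw [norm_div, hnr, ← mul_div_assoc, mul_div_mul_left _ _ hρ.ne']
    gcongr
    have := norm_sub_le (Complex.exp (-(ρ * p) * t)) (Complex.exp (-(ρ * q) * t))
    linarith [norm_nonneg p, norm_nonneg q]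

end Coefficients

/-! ### The eigenvalues `λ±` lie in the open left half plane -/

section Eigenvalues

variable {ν ν' κ : ℝ}

theorem rootK_sq (ν ν' κ : ℝ) :
    rootK ν ν' κ ^ 2 = ((1 - (2 * √κ / (ν + ν')) ^ 2 : ℝ) : ℂ) := by
  have := Complex.cpow_nat_inv_pow ((1 - (2 * √κ / (ν + ν')) ^ 2 : ℝ) : ℂ) (two_ne_zero)
  rw [← this, rootK]
  norm_num

/-- The square `1 - K²` is real and less than `1`, so the root is either purely imaginary or real
with modulus less than `1`. -/
theorem abs_re_rootK_lt_one (hν : 0 < ν + ν') (hκ : 0 < κ) : |(rootK ν ν' κ).re| < 1 := by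
  have h := rootK_sq ν ν' κ
  have hK : 0 < (2 * √κ / (ν + ν')) ^ 2 := by positivity
  set z := rootK ν ν' κ
  have hre := congrArg Complex.re h
  have him := congrArg Complex.im h
  rw [Complex.ofReal_re] at hre
  rw [Complex.ofReal_im] at him
  simp only [pow_two, Complex.mul_re, Complex.mul_im] at hre him
  have h0 : z.re * z.im = 0 := by linarith
  rw [abs_lt]
  rcases mul_eq_zero.1 h0 with h0 | h0
  · rw [h0]; norm_num
  · rw [h0] at hre
    constructor <;> nlinarith

/-- `-λ₊ / |ξ|²`. -/
def rateP (ν ν' κ : ℝ) : ℂ := (((ν + ν') / 2 : ℝ) : ℂ) * (1 + rootK ν ν' κ)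

/-- `-λ₋ / |ξ|²`. -/
def rateM (ν ν' κ : ℝ) : ℂ := (((ν + ν') / 2 : ℝ) : ℂ) * (1 - rootK ν ν' κ)

theorem rateP_re_pos (hν : 0 < ν + ν') (hκ : 0 < κ) : 0 < (rateP ν ν' κ).re := by
  have h := (abs_lt.1 (abs_re_rootK_lt_one hν hκ)).1
  rw [rateP, Complex.re_ofReal_mul, Complex.add_re, Complex.one_re]
  exact mul_pos (by positivity) (by linarith)

theorem rateM_re_pos (hν : 0 < ν + ν') (hκ : 0 < κ) : 0 < (rateM ν ν' κ).re := by
  have h := (abs_lt.1 (abs_re_rootK_lt_one hν hκ)).2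
  rw [rateM, Complex.re_ofReal_mul, Complex.sub_re, Complex.one_re]
  exact mul_pos (by positivity) (by linarith)

variable {n : ℕ}

theorem lamP_eq (ξ : Sp n) :
    lamP ν ν' κ ξ = -(((‖ξ‖ ^ 2 : ℝ) : ℂ) * rateP ν ν' κ) := by
  rw [lamP, rateP]; ring

theorem lamM_eq (ξ : Sp n) :
    lamM ν ν' κ ξ = -(((‖ξ‖ ^ 2 : ℝ) : ℂ) * rateM ν ν' κ) := by
  rw [lamM, rateM]; ring

theorem lamP_add_lamM (ξ : Sp n) :
    lamP ν ν' κ ξ + lamM ν ν' κ ξ = -((ν : ℂ) + ν') * (‖ξ‖ ^ 2 : ℝ) := by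
  rw [lamP, lamM]; push_cast; ring

/-- `(1 + √(1-K²))(1 - √(1-K²)) = K²`, and `K` is chosen so that `((ν+ν')/2)² K² = κ`. -/
theorem lamP_mul_lamM (hν : 0 < ν + ν') (hκ : 0 < κ) (ξ : Sp n) :
    lamP ν ν' κ ξ * lamM ν ν' κ ξ = (κ : ℂ) * ((‖ξ‖ ^ 2 : ℝ) : ℂ) ^ 2 := by
  have h := rootK_sq ν ν' κ
  have h2 : ((ν + ν') / 2) ^ 2 * (2 * √κ / (ν + ν')) ^ 2 = κ := by
    have := Real.sq_sqrt hκ.le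
    field_simp
    linarith
  have h3 : (((ν + ν') / 2 : ℝ) : ℂ) ^ 2 * ((((2 * √κ / (ν + ν')) ^ 2 : ℝ)) : ℂ) = κ := by
    rw [← Complex.ofReal_pow, ← Complex.ofReal_mul, h2]
  rw [Complex.ofReal_sub, Complex.ofReal_one] at h
  rw [lamP, lamM]
  linear_combination (-(((ν + ν') / 2 : ℝ) : ℂ) ^ 2 * ((‖ξ‖ ^ 2 : ℝ) : ℂ) ^ 2) * h
    + ((‖ξ‖ ^ 2 : ℝ) : ℂ) ^ 2 * h3

end Eigenvalues

/-! ### The explicit matrix solves the ODE at each frequency -/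

section SolutionMatrix

variable {n : ℕ}

/-- The space of values of `(φ̂, m̂)` at a frequency. -/
abbrev Val (n : ℕ) : Type := ℂ × (Fin n → ℂ)

/-- The Fourier symbol of `-A`. -/
def genSymbol (ν ν' κ : ℝ) (ξ : Sp n) : Val n →L[ℂ] Val n :=
  LinearMap.toContinuousLinearMap
    { toFun := fun v => (-Complex.I * ∑ j, (ξ j : ℂ) * v.2 j, fun i =>
        -Complex.I * κ * (‖ξ‖ ^ 2 : ℝ) * ξ i * v.1 - ν * (‖ξ‖ ^ 2 : ℝ) * v.2 i
          - ν' * ξ i * ∑ j, (ξ j : ℂ) * v.2 j)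
      map_add' := fun v w => by
        ext i
        · simp only [Prod.fst_add, Prod.snd_add, Pi.add_apply, mul_add, Finset.sum_add_distrib]
        · simp only [Prod.fst_add, Prod.snd_add, Pi.add_apply, mul_add, Finset.sum_add_distrib]
          ring
      map_smul' := fun c v => by
        have h : ∑ j, (ξ j : ℂ) * (c * v.2 j) = c * ∑ j, (ξ j : ℂ) * v.2 j := by
          rw [Finset.mul_sum]
          exact Finset.sum_congr rfl fun j _ => mul_left_comm _ _ _
        ext i
        · simp only [Prod.smul_fst, Prod.smul_snd, Pi.smul_apply, smul_eq_mul, RingHom.id_apply, h]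
          ring
        · simp only [Prod.smul_fst, Prod.smul_snd, Pi.smul_apply, smul_eq_mul, RingHom.id_apply, h]
          ring }

theorem genSymbol_apply (ν ν' κ : ℝ) (ξ : Sp n) (v : Val n) :
    genSymbol ν ν' κ ξ v = (-Complex.I * ∑ j, (ξ j : ℂ) * v.2 j, fun i =>
      -Complex.I * κ * (‖ξ‖ ^ 2 : ℝ) * ξ i * v.1 - ν * (‖ξ‖ ^ 2 : ℝ) * v.2 i
        - ν' * ξ i * ∑ j, (ξ j : ℂ) * v.2 j) := rfl

/-- The action of the solution matrix. -/
def solVec (ν ν' κ : ℝ) (ξ : Sp n) (v : Val n) (t : ℝ) : Val n :=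
  (S11 ν ν' κ t ξ * v.1 + ∑ j, S12 ν ν' κ t ξ j * v.2 j, fun i =>
    S21 ν ν' κ t ξ i * v.1 + ∑ j, S22 ν ν' κ t ξ i j * v.2 j)

variable {ν ν' κ : ℝ}

/-- Here the momentum enters only through `m_i` and the scalar `ξ·m`, which leaves three scalar
functions of time to differentiate. -/
theorem solVec_eq (ξ : Sp n) (v : Val n) (t : ℝ) :
    solVec ν ν' κ ξ v t =
      (coefA (lamP ν ν' κ ξ) (lamM ν ν' κ ξ) t * v.1
        - Complex.I * coefB (lamP ν ν' κ ξ) (lamM ν ν' κ ξ) t * ∑ j, (ξ j : ℂ) * v.2 j,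
      fun i => -Complex.I * κ * (‖ξ‖ ^ 2 : ℝ) * ξ i * v.1 *
          coefB (lamP ν ν' κ ξ) (lamM ν ν' κ ξ) t
        + Complex.exp (-(ν * ‖ξ‖ ^ 2 : ℝ) * t) * v.2 i
        + (coefC (lamP ν ν' κ ξ) (lamM ν ν' κ ξ) t - Complex.exp (-(ν * ‖ξ‖ ^ 2 : ℝ) * t))
          * (ξ i * (∑ j, (ξ j : ℂ) * v.2 j) / (‖ξ‖ ^ 2 : ℝ))) := by
  ext i
  · simp only [solVec, S11, S12]
    rw [sub_eq_add_neg, ← neg_mul, ← neg_mul, Finset.mul_sum]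
    congr 1
    exact Finset.sum_congr rfl fun j _ => by ring
  · simp only [solVec, S21, S22]
    rw [add_assoc]
    congr 1
    · ring
    · have h1 : (-(ν * ‖ξ‖ ^ 2 * t : ℝ) : ℂ) = -(ν * ‖ξ‖ ^ 2 : ℝ) * t := by push_cast; ring
      simp only [h1, add_mul, Finset.sum_add_distrib]
      congr 1
      · simp
      · rw [Finset.mul_sum, Finset.sum_div, Finset.mul_sum]
        exact Finset.sum_congr rfl fun j _ => by ring

theorem sum_mul_self_eq (ξ : Sp n) : ∑ j, (ξ j : ℂ) * (ξ j : ℂ) = ((‖ξ‖ ^ 2 : ℝ) : ℂ) := by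
  rw [EuclideanSpace.norm_sq_eq]
  push_cast
  refine Finset.sum_congr rfl fun j _ => ?_
  rw [← Complex.ofReal_pow, Real.norm_eq_abs, sq_abs]
  push_cast
  ring

theorem solVec_zero {ξ : Sp n} (v : Val n) : solVec ν ν' κ ξ v 0 = v := by
  rw [solVec_eq]
  ext i <;> simp [coefA_zero, coefB_zero, coefC_zero]

/-- The pair `(φ, ξ·m)` obeys a closed 2×2 system with trace `λ₊ + λ₋ = -(ν+ν')|ξ|²` and determinant
`λ₊ λ₋ = κ|ξ|⁴`, while the part of `m` orthogonal to `ξ` follows the heat flow. The condition `ξ ≠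
0` makes `ξ ξᵀ / |ξ|²` a genuine projection. -/
theorem hasDerivAt_solVec (hν : 0 < ν + ν') (hκ : 0 < κ) {ξ : Sp n} (hξ : ξ ≠ 0) (v : Val n)
    (t : ℝ) : HasDerivAt (solVec ν ν' κ ξ v) (genSymbol ν ν' κ ξ (solVec ν ν' κ ξ v t)) t := by
  have hρ : ((‖ξ‖ ^ 2 : ℝ) : ℂ) ≠ 0 := by
    exact_mod_cast (pow_pos (norm_pos_iff.2 hξ) 2).ne'
  have hsum := lamP_add_lamM (ν := ν) (ν' := ν') (κ := κ) ξ
  have hprod := lamP_mul_lamM hν hκ ξ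
  have hA := hasDerivAt_coefA (lamP ν ν' κ ξ) (lamM ν ν' κ ξ) t
  have hB := hasDerivAt_coefB (lamP ν ν' κ ξ) (lamM ν ν' κ ξ) t
  have hC := hasDerivAt_coefC (lamP ν ν' κ ξ) (lamM ν ν' κ ξ) t
  have hE := hasDerivAt_cexp_mul_ofReal (-(ν * ‖ξ‖ ^ 2 : ℝ)) t
  -- Pairing with `ξ` cancels the heat factor, since the projection fixes the direction of `ξ`.
  have hdot : ∑ j, (ξ j : ℂ) * (solVec ν ν' κ ξ v t).2 j =
      -Complex.I * κ * ((‖ξ‖ ^ 2 : ℝ) : ℂ) ^ 2 * v.1 * coefB (lamP ν ν' κ ξ) (lamM ν ν' κ ξ) t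
        + coefC (lamP ν ν' κ ξ) (lamM ν ν' κ ξ) t * ∑ j, (ξ j : ℂ) * v.2 j := by
    set B := coefB (lamP ν ν' κ ξ) (lamM ν ν' κ ξ) t
    set C := coefC (lamP ν ν' κ ξ) (lamM ν ν' κ ξ) t
    set E := Complex.exp (-(ν * ‖ξ‖ ^ 2 : ℝ) * t)
    set ρ := ((‖ξ‖ ^ 2 : ℝ) : ℂ)
    set D := ∑ j, (ξ j : ℂ) * v.2 j with hD
    have h1 : ∀ j, (ξ j : ℂ) * (solVec ν ν' κ ξ v t).2 j =
        (-Complex.I * κ * ρ * v.1 * B + (C - E) * (D / ρ)) * ((ξ j : ℂ) * (ξ j : ℂ))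
          + E * ((ξ j : ℂ) * v.2 j) := fun j => by
      rw [solVec_eq]
      ring
    simp only [h1, Finset.sum_add_distrib, ← Finset.mul_sum, sum_mul_self_eq, ← hD]
    change (_ + _) * ρ + _ = _
    field_simp
    ring
  have hfun : solVec ν ν' κ ξ v = fun t => _ := funext fun t => solVec_eq ξ v t
  rw [genSymbol_apply, hdot, hfun]
  refine HasDerivAt.prodMk ?_ (hasDerivAt_pi.2 fun i => ?_)
  · refine ((hA.mul_const _).sub ((hB.const_mul _).mul_const _)).congr_deriv ?_
    rw [hprod]
    linear_combination (-(κ : ℂ) * ((‖ξ‖ ^ 2 : ℝ) : ℂ) ^ 2 * v.1 *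
      coefB (lamP ν ν' κ ξ) (lamM ν ν' κ ξ) t) * Complex.I_sq
  · refine (((hB.const_mul _).add (hE.mul_const _)).add ((hC.sub hE).mul_const _)).congr_deriv ?_
    simp only [coefC_eq, hsum, hprod]
    -- With `Q = ξ_i D / ρ` treated as an unknown tied to `ρ Q = ξ_i D`, what remains is a
    -- polynomial identity.
    have hQ := mul_div_cancel₀ (ξ i * ∑ j, (ξ j : ℂ) * v.2 j) hρ
    generalize coefA (lamP ν ν' κ ξ) (lamM ν ν' κ ξ) t = a
    generalize coefB (lamP ν ν' κ ξ) (lamM ν ν' κ ξ) t = c at *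
    generalize Complex.exp (-(ν * ‖ξ‖ ^ 2 : ℝ) * t) = E
    generalize ∑ j, (ξ j : ℂ) * v.2 j = D at *
    rw [Complex.ofReal_mul]
    generalize ((‖ξ‖ ^ 2 : ℝ) : ℂ) = ρ at *
    generalize ξ i * D / ρ = Q at *
    linear_combination (-(ν' * (a + -(ν + ν') * ρ * c) + κ * ρ * c)) * hQ
      - κ * ρ * c * ξ i * D * Complex.I_sq

end SolutionMatrix

/-! ### Sobolev weights and their comparison at high frequencies -/

section Weights

variable {n : ℕ}

/-- The monomial `|ξ^α|²`. -/
def monoSq (α : Fin n → ℕ) (ξ : Sp n) : ℝ := ∏ j, (ξ j ^ 2) ^ α j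

theorem monoSq_nonneg (α : Fin n → ℕ) (ξ : Sp n) : 0 ≤ monoSq α ξ :=
  Finset.prod_nonneg fun _ _ => pow_nonneg (sq_nonneg _) _

theorem monoSq_add_single (α : Fin n → ℕ) (j : Fin n) (ξ : Sp n) :
    monoSq (α + Pi.single j 1) ξ = ξ j ^ 2 * monoSq α ξ := by
  simp only [monoSq, Pi.add_apply, pow_add, Finset.prod_mul_distrib]
  rw [mul_comm]
  congr 1
  rw [Finset.prod_eq_single j]
  · simp
  · intro i _ hij
    simp [Pi.single_eq_of_ne hij]
  · simp

/-- The Sobolev weight `∑_{|α| ≤ k} |ξ^α|²`. -/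
def weightSq (k : ℕ) (ξ : Sp n) : ℝ := ∑ α : MultiIndex n k, monoSq (fun i => (α.1 i : ℕ)) ξ

theorem monoSq_le_weightSq {k : ℕ} {α : Fin n → ℕ} (hα : ∑ i, α i ≤ k) (ξ : Sp n) :
    monoSq α ξ ≤ weightSq k ξ := by
  have h1 : ∀ i, α i < k + 1 := fun i =>
    Nat.lt_succ_of_le
      ((Finset.single_le_sum (fun _ _ => Nat.zero_le _) (Finset.mem_univ i)).trans hα)
  exact Finset.single_le_sum (f := fun β : MultiIndex n k => monoSq (fun i => (β.1 i : ℕ)) ξ)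
    (fun β _ => monoSq_nonneg _ ξ)
    (Finset.mem_univ (⟨fun i => ⟨α i, h1 i⟩, hα⟩ : MultiIndex n k))

theorem one_le_weightSq (k : ℕ) (ξ : Sp n) : 1 ≤ weightSq k ξ := by
  have h := monoSq_le_weightSq (k := k) (α := (0 : Fin n → ℕ)) (by simp) ξ
  simpa [monoSq] using h

theorem sum_sq_eq (ξ : Sp n) : ∑ j, ξ j ^ 2 = ‖ξ‖ ^ 2 := by
  simp [EuclideanSpace.norm_sq_eq]

theorem sq_coord_le (ξ : Sp n) (j : Fin n) : ξ j ^ 2 ≤ ‖ξ‖ ^ 2 := by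
  rw [← sum_sq_eq]
  exact Finset.single_le_sum (f := fun j => ξ j ^ 2) (fun _ _ => sq_nonneg _) (Finset.mem_univ j)

/-- Each `ξ_j² |ξ^α|²` is again a monomial of the larger weight; the constant counts the pairs `(α,
j)`. -/
theorem norm_sq_mul_weightSq_le (k : ℕ) (ξ : Sp n) :
    ‖ξ‖ ^ 2 * weightSq k ξ ≤ (Fintype.card (MultiIndex n k) * n : ℝ) * weightSq (k + 1) ξ := by
  have h1 : ∀ α : MultiIndex n k,
      ‖ξ‖ ^ 2 * monoSq (fun i => (α.1 i : ℕ)) ξ ≤ n * weightSq (k + 1) ξ := by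
    intro α
    rw [← sum_sq_eq, Finset.sum_mul]
    have h2 : ∀ j ∈ Finset.univ,
        ξ j ^ 2 * monoSq (fun i => (α.1 i : ℕ)) ξ ≤ weightSq (k + 1) ξ := by
      intro j _
      rw [← monoSq_add_single]
      refine monoSq_le_weightSq ?_ ξ
      simp only [Pi.add_apply, Finset.sum_add_distrib]
      have := α.2
      simpa using this
    simpa using Finset.sum_le_card_nsmul _ _ _ h2
  rw [weightSq, Finset.mul_sum]
  have := Finset.sum_le_card_nsmul Finset.univ _ _ fun α _ => h1 α
  simpa [mul_assoc] using this

/-- A nonzero `β` gives up one factor `ξ_j² ≤ |ξ|²`. Only `β = 0` needs the frequency cutoff,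
through `1 ≤ |ξ|² / r²`. -/
theorem weightSq_succ_le (k : ℕ) {r : ℝ} (hr : 0 < r) {ξ : Sp n} (hξ : r ≤ ‖ξ‖) :
    weightSq (k + 1) ξ ≤
      (Fintype.card (MultiIndex n (k + 1)) * (1 + 1 / r ^ 2)) * (‖ξ‖ ^ 2 * weightSq k ξ) := by
  have hw := one_le_weightSq k ξ
  have h1 : ∀ β : MultiIndex n (k + 1), monoSq (fun i => (β.1 i : ℕ)) ξ
      ≤ (1 + 1 / r ^ 2) * (‖ξ‖ ^ 2 * weightSq k ξ) := by
    intro β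
    by_cases hβ : ∀ i, (β.1 i : ℕ) = 0
    · have h2 : r ^ 2 ≤ ‖ξ‖ ^ 2 := by gcongr
      have h3 : 1 ≤ 1 / r ^ 2 * ‖ξ‖ ^ 2 := by
        rw [one_div, ← div_eq_inv_mul, le_div_iff₀ (by positivity)]
        linarith
      have h4 : 1 ≤ 1 / r ^ 2 * ‖ξ‖ ^ 2 * weightSq k ξ := one_le_mul_of_one_le_of_one_le h3 hw
      have h5 : 0 ≤ ‖ξ‖ ^ 2 * weightSq k ξ := by positivity
      simp only [monoSq, hβ, pow_zero, Finset.prod_const_one]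
      linarith
    · push Not at hβ
      obtain ⟨j, hj⟩ := hβ
      -- The truncated subtraction is exact because `β_j ≠ 0`, so the order drops by one.
      set α : Fin n → ℕ := (fun i => (β.1 i : ℕ)) - Pi.single j 1
      have hα : (fun i => (β.1 i : ℕ)) = α + Pi.single j 1 := by
        ext i
        by_cases hij : i = j
        · subst hij
          simp [α]
          omega
        · simp [α, Pi.single_eq_of_ne hij]
      have hsum : ∑ i, α i ≤ k := by
        have h2 := β.2
        have h3 : ∑ i, (β.1 i : ℕ) = ∑ i, α i + 1 := by
          have := congrArg (fun f : Fin n → ℕ => ∑ i, f i) hα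
          simpa [Finset.sum_add_distrib] using this
        omega
      rw [hα, monoSq_add_single]
      have h5 : 0 ≤ 1 / r ^ 2 * (‖ξ‖ ^ 2 * weightSq k ξ) := by positivity
      have h6 : ξ j ^ 2 * monoSq α ξ ≤ ‖ξ‖ ^ 2 * weightSq k ξ :=
        mul_le_mul (sq_coord_le ξ j) (monoSq_le_weightSq hsum ξ) (monoSq_nonneg _ _)
          (by positivity)
      linarith
  have := Finset.sum_le_card_nsmul Finset.univ _ _ fun β _ => h1 β
  rw [weightSq]
  simpa [mul_assoc] using this

/-- The Sobolev weight `(∑_{|α| ≤ k} |ξ^α|²)^{1/2}`. -/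
def weight (k : ℕ) (ξ : Sp n) : ℝ := √(weightSq k ξ)

theorem weight_pos (k : ℕ) (ξ : Sp n) : 0 < weight k ξ :=
  Real.sqrt_pos.2 (one_pos.trans_le (one_le_weightSq k ξ))

theorem weight_sq (k : ℕ) (ξ : Sp n) : weight k ξ ^ 2 = weightSq k ξ :=
  Real.sq_sqrt (one_pos.trans_le (one_le_weightSq k ξ)).le

theorem continuous_weight (k : ℕ) : Continuous (weight k : Sp n → ℝ) := by
  unfold weight weightSq monoSq
  fun_prop

theorem exists_weight_comparison (n k : ℕ) {r : ℝ} (hr : 0 < r) :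
    ∃ c : ℝ, 0 ≤ c ∧ ∀ ξ : Sp n, r ≤ ‖ξ‖ →
      weight (k + 1) ξ ≤ c * (‖ξ‖ * weight k ξ) ∧ ‖ξ‖ * weight k ξ ≤ c * weight (k + 1) ξ := by
  set a : ℝ := Fintype.card (MultiIndex n k) * n
  set b : ℝ := Fintype.card (MultiIndex n (k + 1)) * (1 + 1 / r ^ 2)
  have ha : 0 ≤ a := by positivity
  have hb : 0 ≤ b := by positivity
  refine ⟨√(a + b), Real.sqrt_nonneg _, fun ξ hξ => ?_⟩
  have hwk := weight_pos k ξ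
  have hwk1 := weight_pos (k + 1) ξ
  constructor
  · refine (sq_le_sq₀ (by positivity) (by positivity)).1 ?_
    rw [mul_pow, mul_pow, Real.sq_sqrt (by positivity), weight_sq, weight_sq]
    refine (weightSq_succ_le k hr hξ).trans ?_
    have := one_le_weightSq k ξ
    gcongr
    linarith
  · refine (sq_le_sq₀ (by positivity) (by positivity)).1 ?_
    rw [mul_pow, mul_pow, Real.sq_sqrt (by positivity), weight_sq, weight_sq]
    refine (norm_sq_mul_weightSq_le k ξ).trans ?_
    have := one_le_weightSq (k + 1) ξ
    gcongr
    linarith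

end Weights

/-! ### Uniform bound for the weighted exponentials -/

section Stability

variable {n : ℕ}

/-- The diagonal operator `(φ, m) ↦ (p φ, q m)`. -/
def scaleVal (n : ℕ) (p q : ℝ) : Val n →L[ℂ] Val n :=
  ((p : ℂ) • ContinuousLinearMap.fst ℂ ℂ (Fin n → ℂ)).prod
    ((q : ℂ) • ContinuousLinearMap.snd ℂ ℂ (Fin n → ℂ))

theorem scaleVal_apply (p q : ℝ) (v : Val n) : scaleVal n p q v = ((p : ℂ) * v.1, (q : ℂ) • v.2) :=
  rfl

/-- The symbol of `-A` in the weighted variables. -/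
def wSymbol (ν ν' κ : ℝ) (k : ℕ) (ξ : Sp n) : Val n →L[ℂ] Val n :=
  scaleVal n (weight (k + 1) ξ) (weight k ξ) ∘L genSymbol ν ν' κ ξ ∘L
    scaleVal n (weight (k + 1) ξ)⁻¹ (weight k ξ)⁻¹

theorem scaleVal_scaleVal_inv (k l : ℕ) (ξ : Sp n) (v : Val n) :
    scaleVal n (weight k ξ) (weight l ξ) (scaleVal n (weight k ξ)⁻¹ (weight l ξ)⁻¹ v) = v := by
  have h1 : (weight k ξ : ℂ) ≠ 0 := Complex.ofReal_ne_zero.2 (weight_pos k ξ).ne'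
  have h2 : (weight l ξ : ℂ) ≠ 0 := Complex.ofReal_ne_zero.2 (weight_pos l ξ).ne'
  simp only [scaleVal_apply, Complex.ofReal_inv, smul_smul, ← mul_assoc, mul_inv_cancel₀ h1,
    mul_inv_cancel₀ h2, one_mul, one_smul]

theorem scaleVal_inv_scaleVal (k l : ℕ) (ξ : Sp n) (v : Val n) :
    scaleVal n (weight k ξ)⁻¹ (weight l ξ)⁻¹ (scaleVal n (weight k ξ) (weight l ξ) v) = v := by
  have h1 : (weight k ξ : ℂ) ≠ 0 := Complex.ofReal_ne_zero.2 (weight_pos k ξ).ne'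
  have h2 : (weight l ξ : ℂ) ≠ 0 := Complex.ofReal_ne_zero.2 (weight_pos l ξ).ne'
  simp only [scaleVal_apply, Complex.ofReal_inv, smul_smul, ← mul_assoc, inv_mul_cancel₀ h1,
    inv_mul_cancel₀ h2, one_mul, one_smul]

variable {ν ν' κ : ℝ}

theorem wSymbol_scaleVal (k : ℕ) (ξ : Sp n) (v : Val n) :
    wSymbol ν ν' κ k ξ (scaleVal n (weight (k + 1) ξ) (weight k ξ) v) =
      scaleVal n (weight (k + 1) ξ) (weight k ξ) (genSymbol ν ν' κ ξ v) := by
  simp only [wSymbol, ContinuousLinearMap.comp_apply, scaleVal_inv_scaleVal]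

/-- The weighted solution curve satisfies `y' = b y` with `b` the weighted symbol, so ODE uniqueness
makes it the exponential orbit. -/
theorem exp_wSymbol_scaleVal (hν : 0 < ν + ν') (hκ : 0 < κ) (k : ℕ) {ξ : Sp n} (hξ : ξ ≠ 0)
    (v : Val n) (t : ℝ) :
    NormedSpace.exp (t • wSymbol ν ν' κ k ξ) (scaleVal n (weight (k + 1) ξ) (weight k ξ) v) =
      scaleVal n (weight (k + 1) ξ) (weight k ξ) (solVec ν ν' κ ξ v t) := by
  have h := eq_clm_exp_of_hasDerivAt (wSymbol ν ν' κ k ξ)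
    (fun t => scaleVal n (weight (k + 1) ξ) (weight k ξ) (solVec ν ν' κ ξ v t)) (fun t => by
      rw [wSymbol_scaleVal]
      exact ((scaleVal n (weight (k + 1) ξ) (weight k ξ)).restrictScalars
        ℝ).hasFDerivAt.comp_hasDerivAt t (hasDerivAt_solVec hν hκ hξ v t)) t
  rw [solVec_zero] at h
  exact h.symm

theorem continuous_wSymbol (k : ℕ) : Continuous fun ξ : Sp n => wSymbol ν ν' κ k ξ := by
  rw [continuous_clm_apply]
  intro v
  have h1 := continuous_weight (n := n) k
  have h2 := continuous_weight (n := n) (k + 1)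
  have h1' : Continuous fun ξ : Sp n => (weight k ξ)⁻¹ := h1.inv₀ fun ξ => (weight_pos k ξ).ne'
  have h2' : Continuous fun ξ : Sp n => (weight (k + 1) ξ)⁻¹ :=
    h2.inv₀ fun ξ => (weight_pos (k + 1) ξ).ne'
  simp only [wSymbol, ContinuousLinearMap.comp_apply, scaleVal_apply, genSymbol_apply,
    Pi.smul_apply]
  fun_prop

/-- The diagonal blocks are bounded outright. `S₁₂` is of size `|ξ|⁻¹` and `S₂₁` of size `|ξ|`,
exactly compensating the ratio of the two weights. -/
theorem exists_norm_solVec_le (hν₀ : 0 ≤ ν) (hν : 0 < ν + ν') (hκ : 0 < κ) (k : ℕ) {r : ℝ}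
    (hr : 0 < r) :
    ∃ C : ℝ, ∀ (ξ : Sp n) (t : ℝ) (v : Val n), r ≤ ‖ξ‖ → 0 ≤ t →
      ‖scaleVal n (weight (k + 1) ξ) (weight k ξ) (solVec ν ν' κ ξ v t)‖ ≤
        C * ‖scaleVal n (weight (k + 1) ξ) (weight k ξ) v‖ := by
  obtain ⟨c, hc0, hc⟩ := exists_weight_comparison n k hr
  obtain ⟨B, hB0, hB⟩ := exists_coef_bound (rateP_re_pos hν hκ) (rateM_re_pos hν hκ)
  -- The sum of the bounds for the two rows, so that it exceeds each of them in the maximum norm.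
  refine ⟨(B + n * (c * B)) + (κ * c * B + n * (1 + (B + 1))), fun ξ t v hξ ht => ?_⟩
  have hξ0 : 0 < ‖ξ‖ := hr.trans_le hξ
  obtain ⟨hA, hBB, hC⟩ := hB (‖ξ‖ ^ 2) t (by positivity) ht
  rw [← lamP_eq, ← lamM_eq] at hA hBB hC
  obtain ⟨hw1, hw2⟩ := hc ξ hξ
  set p := weight (k + 1) ξ
  set q := weight k ξ
  have hp : 0 < p := weight_pos _ _
  have hq : 0 < q := weight_pos _ _
  set N := ‖scaleVal n p q v‖
  have hN1 : p * ‖v.1‖ ≤ N := by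
    have h := norm_fst_le (scaleVal n p q v)
    rwa [scaleVal_apply, norm_mul, Complex.norm_real, Real.norm_of_nonneg hp.le,
      ← scaleVal_apply] at h
  have hN2 : ∀ j, q * ‖v.2 j‖ ≤ N := fun j => by
    have h := (norm_le_pi_norm (scaleVal n p q v).2 j).trans (norm_snd_le (scaleVal n p q v))
    have h2 : (scaleVal n p q v).2 j = (q : ℂ) * v.2 j := rfl
    rwa [h2, norm_mul, Complex.norm_real, Real.norm_of_nonneg hq.le] at h
  have hN0 : 0 ≤ N := norm_nonneg _
  have hcoord : ∀ j, |ξ j| ≤ ‖ξ‖ := fun j => by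
    rw [← Real.norm_eq_abs]; exact PiLp.norm_apply_le ξ j
  have hE : ‖Complex.exp (-(ν * ‖ξ‖ ^ 2 * t : ℝ))‖ ≤ 1 := by
    rw [← Complex.ofReal_neg, Complex.norm_exp_ofReal, Real.exp_le_one_iff]
    have : 0 ≤ ν * ‖ξ‖ ^ 2 * t := by positivity
    linarith
  have e11 : ‖S11 ν ν' κ t ξ‖ ≤ B := hA
  -- One factor `|ξ|` comes from the entry and one from trading `p` for `c |ξ| q`; together they are
  -- absorbed by the bound on `|ξ|² coefB`.
  have e12 : ∀ j, p * ‖S12 ν ν' κ t ξ j‖ ≤ c * B * q := fun j => by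
    have : ‖S12 ν ν' κ t ξ j‖ ≤ ‖coefB (lamP ν ν' κ ξ) (lamM ν ν' κ ξ) t‖ * ‖ξ‖ := by
      simp only [S12, norm_mul, norm_neg, Complex.norm_I, one_mul, Complex.norm_real,
        Real.norm_eq_abs]
      gcongr
      exact hcoord j
    calc p * ‖S12 ν ν' κ t ξ j‖
        ≤ (c * (‖ξ‖ * q)) * (‖coefB (lamP ν ν' κ ξ) (lamM ν ν' κ ξ) t‖ * ‖ξ‖) := by gcongr
      _ = c * q * (‖ξ‖ ^ 2 * ‖coefB (lamP ν ν' κ ξ) (lamM ν ν' κ ξ) t‖) := by ring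
      _ ≤ c * q * B := by gcongr
      _ = c * B * q := by ring
  have e21 : ∀ i, q * ‖S21 ν ν' κ t ξ i‖ ≤ κ * c * B * p := fun i => by
    have : ‖S21 ν ν' κ t ξ i‖ ≤
        ‖ξ‖ * κ * ‖ξ‖ ^ 2 * ‖coefB (lamP ν ν' κ ξ) (lamM ν ν' κ ξ) t‖ := by
      simp only [S21, norm_mul, norm_neg, Complex.norm_I, one_mul, Complex.norm_real,
        Real.norm_eq_abs, abs_of_pos hκ, abs_of_nonneg (sq_nonneg ‖ξ‖)]
      gcongr
      exact hcoord i
    calc q * ‖S21 ν ν' κ t ξ i‖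
        ≤ q * (‖ξ‖ * κ * ‖ξ‖ ^ 2 * ‖coefB (lamP ν ν' κ ξ) (lamM ν ν' κ ξ) t‖) := by gcongr
      _ = κ * (‖ξ‖ * q) * (‖ξ‖ ^ 2 * ‖coefB (lamP ν ν' κ ξ) (lamM ν ν' κ ξ) t‖) := by ring
      _ ≤ κ * (c * p) * B := by gcongr
      _ = κ * c * B * p := by ring
  have e22 : ∀ i j, ‖S22 ν ν' κ t ξ i j‖ ≤ 1 + (B + 1) := fun i j => by
    have h1 : ‖(ξ i : ℂ) * (ξ j : ℂ) / (‖ξ‖ ^ 2 : ℝ)‖ ≤ 1 := by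
      rw [norm_div, norm_mul, Complex.norm_real, Complex.norm_real, Complex.norm_real,
        Real.norm_eq_abs, Real.norm_eq_abs, Real.norm_of_nonneg (sq_nonneg _),
        div_le_one (by positivity), sq]
      exact mul_le_mul (hcoord i) (hcoord j) (abs_nonneg _) hξ0.le
    have h2 : ‖(if i = j then (1 : ℂ) else 0)‖ ≤ 1 := by split_ifs <;> simp
    rw [S22]
    refine (norm_add_le _ _).trans ?_
    rw [norm_mul, norm_mul]
    have h3 : ‖coefC (lamP ν ν' κ ξ) (lamM ν ν' κ ξ) t - Complex.exp (-(ν * ‖ξ‖ ^ 2 * t : ℝ))‖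
        ≤ B + 1 := (norm_sub_le _ _).trans (add_le_add hC hE)
    refine add_le_add (mul_le_one₀ hE (norm_nonneg _) h2) ?_
    exact (mul_le_mul h3 h1 (norm_nonneg _) (by positivity)).trans_eq (mul_one _)
  have b1 : p * ‖(solVec ν ν' κ ξ v t).1‖ ≤ (B + n * (c * B)) * N := by
    have hs : ‖∑ j, S12 ν ν' κ t ξ j * v.2 j‖ ≤ ∑ j, ‖S12 ν ν' κ t ξ j‖ * ‖v.2 j‖ :=
      (norm_sum_le _ _).trans (Finset.sum_le_sum fun j _ => (norm_mul _ _).le)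
    have hs2 : ∑ j, p * (‖S12 ν ν' κ t ξ j‖ * ‖v.2 j‖) ≤ n * (c * B * N) := by
      have : ∀ j ∈ Finset.univ, p * (‖S12 ν ν' κ t ξ j‖ * ‖v.2 j‖) ≤ c * B * N := fun j _ =>
        calc p * (‖S12 ν ν' κ t ξ j‖ * ‖v.2 j‖) = (p * ‖S12 ν ν' κ t ξ j‖) * ‖v.2 j‖ := by ring
          _ ≤ (c * B * q) * ‖v.2 j‖ := mul_le_mul_of_nonneg_right (e12 j) (norm_nonneg _)
          _ = c * B * (q * ‖v.2 j‖) := by ring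
          _ ≤ c * B * N := by gcongr; exact hN2 j
      simpa using Finset.sum_le_card_nsmul _ _ _ this
    calc p * ‖(solVec ν ν' κ ξ v t).1‖
        ≤ p * (‖S11 ν ν' κ t ξ‖ * ‖v.1‖ + ∑ j, ‖S12 ν ν' κ t ξ j‖ * ‖v.2 j‖) := by
          gcongr
          refine (norm_add_le _ _).trans ?_
          rw [norm_mul]
          gcongr
      _ = ‖S11 ν ν' κ t ξ‖ * (p * ‖v.1‖) + ∑ j, p * (‖S12 ν ν' κ t ξ j‖ * ‖v.2 j‖) := by
          rw [mul_add, Finset.mul_sum]; ring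
      _ ≤ B * N + n * (c * B * N) := by gcongr
      _ = _ := by ring
  have b2 : ∀ i, q * ‖(solVec ν ν' κ ξ v t).2 i‖ ≤ (κ * c * B + n * (1 + (B + 1))) * N := by
    intro i
    have hs : ‖∑ j, S22 ν ν' κ t ξ i j * v.2 j‖ ≤ ∑ j, ‖S22 ν ν' κ t ξ i j‖ * ‖v.2 j‖ :=
      (norm_sum_le _ _).trans (Finset.sum_le_sum fun j _ => (norm_mul _ _).le)
    have hs2 : ∑ j, q * (‖S22 ν ν' κ t ξ i j‖ * ‖v.2 j‖) ≤ n * ((1 + (B + 1)) * N) := by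
      have : ∀ j ∈ Finset.univ, q * (‖S22 ν ν' κ t ξ i j‖ * ‖v.2 j‖) ≤ (1 + (B + 1)) * N :=
        fun j _ =>
        calc q * (‖S22 ν ν' κ t ξ i j‖ * ‖v.2 j‖) = ‖S22 ν ν' κ t ξ i j‖ * (q * ‖v.2 j‖) := by
              ring
          _ ≤ (1 + (B + 1)) * N := by
              gcongr
              · exact e22 i j
              · exact hN2 j
      simpa using Finset.sum_le_card_nsmul _ _ _ this
    calc q * ‖(solVec ν ν' κ ξ v t).2 i‖
        ≤ q * (‖S21 ν ν' κ t ξ i‖ * ‖v.1‖ + ∑ j, ‖S22 ν ν' κ t ξ i j‖ * ‖v.2 j‖) := by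
          gcongr
          refine (norm_add_le _ _).trans ?_
          rw [norm_mul]
          gcongr
      _ = (q * ‖S21 ν ν' κ t ξ i‖) * ‖v.1‖ + ∑ j, q * (‖S22 ν ν' κ t ξ i j‖ * ‖v.2 j‖) := by
          rw [mul_add, Finset.mul_sum]; ring
      _ ≤ (κ * c * B * p) * ‖v.1‖ + n * ((1 + (B + 1)) * N) := by
          exact add_le_add (mul_le_mul_of_nonneg_right (e21 i) (norm_nonneg _)) hs2
      _ = κ * c * B * (p * ‖v.1‖) + n * ((1 + (B + 1)) * N) := by ring
      _ ≤ κ * c * B * N + n * ((1 + (B + 1)) * N) := by gcongr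
      _ = _ := by ring
  have hc1 : 0 ≤ (B + n * (c * B)) * N := by positivity
  have hc2 : 0 ≤ (κ * c * B + n * (1 + (B + 1))) * N := by positivity
  rw [scaleVal_apply, Prod.norm_def, add_mul]
  refine max_le ?_ ((pi_norm_le_iff_of_nonneg (by positivity)).2 fun i => ?_)
  · rw [norm_mul, Complex.norm_real, Real.norm_of_nonneg hp.le]
    linarith
  · change ‖(q : ℂ) * (solVec ν ν' κ ξ v t).2 i‖ ≤ _
    rw [norm_mul, Complex.norm_real, Real.norm_of_nonneg hq.le]
    linarith [b2 i]

theorem exists_norm_exp_wSymbol_le (n : ℕ) (hν₀ : 0 ≤ ν) (hν : 0 < ν + ν') (hκ : 0 < κ) (k : ℕ)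
    {r : ℝ} (hr : 0 < r) :
    ∃ C : ℝ, ∀ (ξ : Sp n), r ≤ ‖ξ‖ → ∀ t : ℝ≥0,
      ‖NormedSpace.exp ((t : ℝ) • wSymbol ν ν' κ k ξ)‖ ≤ C := by
  obtain ⟨C, hC⟩ := exists_norm_solVec_le (n := n) hν₀ hν hκ k hr
  refine ⟨|C|, fun ξ hξ t => ContinuousLinearMap.opNorm_le_bound _ (abs_nonneg C) fun v => ?_⟩
  have hξ0 : ξ ≠ 0 := norm_pos_iff.1 (hr.trans_le hξ)
  have h := hC ξ t (scaleVal n (weight (k + 1) ξ)⁻¹ (weight k ξ)⁻¹ v) hξ t.2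
  rw [← exp_wSymbol_scaleVal hν hκ k hξ0, scaleVal_scaleVal_inv] at h
  exact h.trans (by gcongr; exact le_abs_self C)

end Stability

/-! ### Restriction, extension by zero, and vector-valued `L²` -/

section RestrictExtend

variable {Ω : Type*} [MeasurableSpace Ω] {μ : Measure Ω}

/-- Restriction of `L²` functions to a subset. -/
def restrictL2 (μ : Measure Ω) (A : Set Ω) : Lp ℂ 2 μ →L[ℂ] Lp ℂ 2 (μ.restrict A) :=
  LinearMap.mkContinuous
    { toFun := fun f => ((Lp.memLp f).restrict A).toLp f
      map_add' := fun f g => by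
        rw [← MemLp.toLp_add]
        exact MemLp.toLp_congr _ _ (ae_restrict_of_ae (Lp.coeFn_add f g))
      map_smul' := fun c f => by
        rw [RingHom.id_apply, ← MemLp.toLp_const_smul]
        exact MemLp.toLp_congr _ _ (ae_restrict_of_ae (Lp.coeFn_smul c f)) } 1 (by
    intro f
    simp only [LinearMap.coe_mk, AddHom.coe_mk, one_mul, Lp.norm_toLp]
    rw [Lp.norm_def]
    exact ENNReal.toReal_mono (Lp.eLpNorm_ne_top f)
      (eLpNorm_mono_measure _ Measure.restrict_le_self))

theorem coeFn_restrictL2 (A : Set Ω) (f : Lp ℂ 2 μ) :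
    restrictL2 μ A f =ᵐ[μ.restrict A] f :=
  MemLp.coeFn_toLp ((Lp.memLp f).restrict A)

theorem memLp_indicator_coeFn {A : Set Ω} (hA : MeasurableSet A) (f : Lp ℂ 2 (μ.restrict A)) :
    MemLp (A.indicator (fun x => f x)) 2 μ :=
  (memLp_indicator_iff_restrict hA).2 (Lp.memLp f)

/-- Extension of `L²` functions by zero. -/
def extendL2 (μ : Measure Ω) {A : Set Ω} (hA : MeasurableSet A) :
    Lp ℂ 2 (μ.restrict A) →L[ℂ] Lp ℂ 2 μ :=
  LinearMap.mkContinuous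
    { toFun := fun f => (memLp_indicator_coeFn hA f).toLp _
      map_add' := fun f g => by
        rw [← MemLp.toLp_add]
        refine MemLp.toLp_congr _ _ ?_
        filter_upwards [(ae_restrict_iff' hA).1 (Lp.coeFn_add f g)] with x hx
        by_cases hxA : x ∈ A
        · simpa [hxA] using hx hxA
        · simp [hxA]
      map_smul' := fun c f => by
        rw [RingHom.id_apply, ← MemLp.toLp_const_smul]
        refine MemLp.toLp_congr _ _ ?_
        filter_upwards [(ae_restrict_iff' hA).1 (Lp.coeFn_smul c f)] with x hx
        by_cases hxA : x ∈ A
        · simpa [hxA] using hx hxA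
        · simp [hxA] } 1 (by
    intro f
    simp only [LinearMap.coe_mk, AddHom.coe_mk, one_mul, Lp.norm_toLp]
    rw [eLpNorm_indicator_eq_eLpNorm_restrict hA, Lp.norm_def])

theorem coeFn_extendL2 {A : Set Ω} (hA : MeasurableSet A) (f : Lp ℂ 2 (μ.restrict A)) :
    extendL2 μ hA f =ᵐ[μ] A.indicator (fun x => f x) := by
  have h : extendL2 μ hA f = (memLp_indicator_coeFn hA f).toLp _ := rfl
  rw [h]
  exact MemLp.coeFn_toLp _

/-- The tuple of components of a function with values in `ℂ × ℂⁿ`. -/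
def valComponents (n : ℕ) (μ : Measure Ω) :
    Lp (Val n) 2 μ →L[ℂ] (Lp ℂ 2 μ × (Fin n → Lp ℂ 2 μ)) :=
  ((ContinuousLinearMap.fst ℂ ℂ (Fin n → ℂ)).compLpL 2 μ).prod
    (ContinuousLinearMap.pi fun j => ((ContinuousLinearMap.proj j).comp
      (ContinuousLinearMap.snd ℂ ℂ (Fin n → ℂ))).compLpL 2 μ)

/-- The function with values in `ℂ × ℂⁿ` with given components. -/
def valOfComponents (n : ℕ) (μ : Measure Ω) :
    (Lp ℂ 2 μ × (Fin n → Lp ℂ 2 μ)) →L[ℂ] Lp (Val n) 2 μ :=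
  ((ContinuousLinearMap.inl ℂ ℂ (Fin n → ℂ)).compLpL 2 μ).comp (ContinuousLinearMap.fst ℂ _ _) +
    ∑ j, ((ContinuousLinearMap.inr ℂ ℂ (Fin n → ℂ)).comp
      (ContinuousLinearMap.single ℂ (fun _ : Fin n => ℂ) j)).compLpL 2 μ ∘L
        (ContinuousLinearMap.proj j) ∘L (ContinuousLinearMap.snd ℂ _ _)

theorem coeFn_valOfComponents (n : ℕ) (g : Lp ℂ 2 μ × (Fin n → Lp ℂ 2 μ)) :
    valOfComponents n μ g =ᵐ[μ] fun x => (g.1 x, fun j => g.2 j x) := by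
  have h : valOfComponents n μ g = (ContinuousLinearMap.inl ℂ ℂ (Fin n → ℂ)).compLpL 2 μ g.1 +
      ∑ j, ((ContinuousLinearMap.inr ℂ ℂ (Fin n → ℂ)).comp
        (ContinuousLinearMap.single ℂ (fun _ : Fin n => ℂ) j)).compLpL 2 μ (g.2 j) := by
    simp [valOfComponents]
  rw [h]
  have h1 := ae_all_iff.2 fun j => ContinuousLinearMap.coeFn_compLpL
    ((ContinuousLinearMap.inr ℂ ℂ (Fin n → ℂ)).comp
        (ContinuousLinearMap.single ℂ (fun _ : Fin n => ℂ) j)) (g.2 j)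
  filter_upwards [Lp.coeFn_add ((ContinuousLinearMap.inl ℂ ℂ (Fin n → ℂ)).compLpL 2 μ g.1)
    (∑ j, ((ContinuousLinearMap.inr ℂ ℂ (Fin n → ℂ)).comp
        (ContinuousLinearMap.single ℂ (fun _ : Fin n => ℂ) j)).compLpL 2 μ (g.2 j)),
    Lp.coeFn_fun_finsetSum Finset.univ (fun j => ((ContinuousLinearMap.inr ℂ ℂ (Fin n → ℂ)).comp
        (ContinuousLinearMap.single ℂ (fun _ : Fin n => ℂ) j)).compLpL 2 μ (g.2 j)),
    (ContinuousLinearMap.inl ℂ ℂ (Fin n → ℂ)).coeFn_compLpL g.1, h1] with x e1 e2 e3 e4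
  rw [e1, Pi.add_apply, e2, e3]
  simp only [e4]
  ext i
  · simp [Prod.fst_sum]
  · simp [Prod.snd_sum, Finset.sum_apply, Pi.single_apply]

theorem coeFn_valComponents_fst (n : ℕ) (f : Lp (Val n) 2 μ) :
    (valComponents n μ f).1 =ᵐ[μ] fun x => (f x).1 :=
  (ContinuousLinearMap.fst ℂ ℂ (Fin n → ℂ)).coeFn_compLpL f

theorem coeFn_valComponents_snd (n : ℕ) (f : Lp (Val n) 2 μ) (j : Fin n) :
    (valComponents n μ f).2 j =ᵐ[μ] fun x => (f x).2 j :=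
  ((ContinuousLinearMap.proj j).comp (ContinuousLinearMap.snd ℂ ℂ (Fin n → ℂ))).coeFn_compLpL f

/-- An `L²` function with values in `ℂ × ℂⁿ` is a tuple of `L²` functions. -/
def lpValEquiv (n : ℕ) (μ : Measure Ω) :
    (Lp ℂ 2 μ × (Fin n → Lp ℂ 2 μ)) ≃L[ℂ] Lp (Val n) 2 μ :=
  ContinuousLinearEquiv.equivOfInverse (valOfComponents n μ) (valComponents n μ)
    (fun g => by
      refine Prod.ext (Lp.ext ?_) (funext fun j => Lp.ext ?_)
      · filter_upwards [coeFn_valComponents_fst n (valOfComponents n μ g),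
          coeFn_valOfComponents n g] with x h1 h2
        rw [h1, h2]
      · filter_upwards [coeFn_valComponents_snd n (valOfComponents n μ g) j,
          coeFn_valOfComponents n g] with x h1 h2
        rw [h1, h2])
    (fun f => by
      refine Lp.ext ?_
      filter_upwards [coeFn_valComponents_fst n f,
        ae_all_iff.2 fun j => coeFn_valComponents_snd n f j,
        coeFn_valOfComponents n (valComponents n μ f)] with x h1 h2 h3
      rw [h3]
      exact Prod.ext h1 (funext h2))

/-- The `ℓ²` product norms are equivalent to the maximum norms. -/
def withLpProdEquiv (n : ℕ) (Y Z : Type*) [NormedAddCommGroup Y] [NormedSpace ℂ Y]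
    [NormedAddCommGroup Z] [NormedSpace ℂ Z] :
    WithLp 2 (Y × PiLp 2 fun _ : Fin n => Z) ≃L[ℂ] (Y × (Fin n → Z)) :=
  (WithLp.prodContinuousLinearEquiv 2 ℂ Y (PiLp 2 fun _ : Fin n => Z)).trans
    ((ContinuousLinearEquiv.refl ℂ Y).prodCongr (PiLp.continuousLinearEquiv 2 ℂ fun _ : Fin n => Z))

/-- Componentwise identifications of a product with `L²`. -/
def withLpValEquiv (n : ℕ) {Y Z : Type*} [NormedAddCommGroup Y] [NormedSpace ℂ Y]
    [NormedAddCommGroup Z] [NormedSpace ℂ Z] (a : Y ≃L[ℂ] Lp ℂ 2 μ) (b : Z ≃L[ℂ] Lp ℂ 2 μ) :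
    WithLp 2 (Y × PiLp 2 fun _ : Fin n => Z) ≃L[ℂ] Lp (Val n) 2 μ :=
  (withLpProdEquiv n Y Z).trans
    ((a.prodCongr (ContinuousLinearEquiv.piCongrRight fun _ => b)).trans (lpValEquiv n μ))

theorem coeFn_withLpValEquiv (n : ℕ) {Y Z : Type*} [NormedAddCommGroup Y] [NormedSpace ℂ Y]
    [NormedAddCommGroup Z] [NormedSpace ℂ Z] (a : Y ≃L[ℂ] Lp ℂ 2 μ) (b : Z ≃L[ℂ] Lp ℂ 2 μ)
    (u : WithLp 2 (Y × PiLp 2 fun _ : Fin n => Z)) :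
    withLpValEquiv n a b u =ᵐ[μ] fun x => (a u.fst x, fun j => b (u.snd j) x) :=
  coeFn_valOfComponents n (a u.fst, fun j => b (u.snd j))

end RestrictExtend

/-! ### `H^k_(∞)` as an `L²` space of high frequencies -/

section SobolevEquiv

variable {n : ℕ}

/-- The frequencies `η` with `|2πη| ≥ r`. -/
def highSet (n : ℕ) (r : ℝ) : Set (Sp n) := {η | r ≤ ‖(2 * Real.pi) • η‖}

theorem measurableSet_highSet (n : ℕ) (r : ℝ) : MeasurableSet (highSet n r) :=
  measurableSet_le measurable_const (by fun_prop)

/-- The symbol `(iξ)^α`. -/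
def derivSymbol (α : Fin n → ℕ) (η : Sp n) : ℂ :=
  ∏ j, (Complex.I * (((2 * Real.pi) • η) j : ℝ)) ^ α j

theorem norm_derivSymbol_sq (α : Fin n → ℕ) (η : Sp n) :
    ‖derivSymbol α η‖ ^ 2 = monoSq α ((2 * Real.pi) • η) := by
  rw [derivSymbol, norm_prod, ← Finset.prod_pow, monoSq]
  refine Finset.prod_congr rfl fun j _ => ?_
  rw [norm_pow, norm_mul, Complex.norm_I, one_mul, Complex.norm_real, ← pow_mul,
    mul_comm (α j), pow_mul, Real.norm_eq_abs, sq_abs]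

/-- The normalized symbol `(iξ)^α / w_k(ξ)`. -/
def normSymbol (k : ℕ) (α : Fin n → ℕ) (η : Sp n) : ℂ :=
  derivSymbol α η / (weight k ((2 * Real.pi) • η) : ℝ)

theorem continuous_normSymbol (k : ℕ) (α : Fin n → ℕ) :
    Continuous (normSymbol k α : Sp n → ℂ) := by
  unfold normSymbol derivSymbol
  have h : Continuous fun η : Sp n => weight k ((2 * Real.pi) • η) :=
    (continuous_weight k).comp (by fun_prop)
  refine Continuous.div (by fun_prop) (by fun_prop) fun η => ?_
  exact Complex.ofReal_ne_zero.2 (weight_pos _ _).ne'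

theorem norm_normSymbol_le_one {k : ℕ} {α : Fin n → ℕ} (hα : ∑ i, α i ≤ k) (η : Sp n) :
    ‖normSymbol k α η‖ ≤ 1 := by
  have hw := weight_pos k ((2 * Real.pi) • η)
  rw [normSymbol, norm_div, Complex.norm_real, Real.norm_of_nonneg hw.le, div_le_one hw]
  refine (sq_le_sq₀ (norm_nonneg _) hw.le).1 ?_
  rw [norm_derivSymbol_sq, weight_sq]
  exact monoSq_le_weightSq hα _

/-- Each term is `|ξ^α|² / w_k`, and these add up to `w_k`. Thus `w_k f̂` is a combination, with
symbols bounded by `1`, of the transforms of the recorded derivatives, which makes the weighted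
Fourier transform continuous for the jet norm. -/
theorem sum_conj_normSymbol_mul (k : ℕ) (η : Sp n) :
    ∑ α : MultiIndex n k, (starRingEnd ℂ) (normSymbol k (fun i => (α.1 i : ℕ)) η) *
      derivSymbol (fun i => (α.1 i : ℕ)) η = (weight k ((2 * Real.pi) • η) : ℂ) := by
  have hw := weight_pos k ((2 * Real.pi) • η)
  have h1 : ∀ α : MultiIndex n k, (starRingEnd ℂ) (normSymbol k (fun i => (α.1 i : ℕ)) η) *
      derivSymbol (fun i => (α.1 i : ℕ)) η =
        ((monoSq (fun i => (α.1 i : ℕ)) ((2 * Real.pi) • η) /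
          weight k ((2 * Real.pi) • η) : ℝ) : ℂ) := fun α => by
    rw [normSymbol, map_div₀, Complex.conj_ofReal, div_mul_eq_mul_div, Complex.conj_mul',
      ← Complex.ofReal_pow, norm_derivSymbol_sq, Complex.ofReal_div]
  simp only [h1]
  rw [← Complex.ofReal_sum, ← Finset.sum_div]
  change ((weightSq k ((2 * Real.pi) • η) / weight k ((2 * Real.pi) • η) : ℝ) : ℂ) = _
  rw [← weight_sq, sq, mul_div_cancel_right₀ _ hw.ne']

/-- Multiplication by a bounded continuous function on `L²(ℝⁿ)`. -/
def mulL2 (m : Sp n → ℂ) (hm : Continuous m) (hb : ∀ η, ‖m η‖ ≤ 1) : L2 n →L[ℂ] L2 n :=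
  opMul (fun η => m η • ContinuousLinearMap.id ℂ ℂ)
    ⟨(hm.smul continuous_const).aestronglyMeasurable, 1, Eventually.of_forall fun η => by
      rw [norm_smul]
      exact mul_le_one₀ (hb η) (norm_nonneg _) ContinuousLinearMap.norm_id_le⟩

theorem coeFn_mulL2 (m : Sp n → ℂ) (hm : Continuous m) (hb : ∀ η, ‖m η‖ ≤ 1) (f : L2 n) :
    mulL2 m hm hb f =ᵐ[volume] fun η => m η * f η :=
  coeFn_opMul _ _ f

/-- The function underlying an element of `H^k_(∞)`. -/
def highFn {k : ℕ} {r : ℝ} (F : HHigh n k r) : L2 n := evalZero n k F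

theorem fourier_jet_eq {k : ℕ} {r : ℝ} (F : HHigh n k r) (α : MultiIndex n k) :
    (𝓕 ((F : PiLp 2 fun _ : MultiIndex n k => L2 n) α) : L2 n) =ᵐ[volume]
      fun η => derivSymbol (fun i => (α.1 i : ℕ)) η * (𝓕 (highFn F) : L2 n) η :=
  (((hasFourier_toDistr (highFn F)).multiDeriv fun i => (α.1 i : ℕ)).toDistr_eq_iff _).1 (F.2.1 α)

theorem fourier_highFn_eq_zero {k : ℕ} {r : ℝ} (F : HHigh n k r) :
    ∀ᵐ η : Sp n, η ∉ highSet n r → (𝓕 (highFn F) : L2 n) η = 0 := by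
  have h : ∀ᵐ η : Sp n, ‖(2 * Real.pi) • η‖ < r → (𝓕 (highFn F) : L2 n) η = 0 := F.2.2
  filter_upwards [h] with η hη hr
  exact hη (not_le.1 hr)

theorem eq_of_fourier_ae_eq {f g : L2 n} (h : (𝓕 f : L2 n) =ᵐ[volume] (𝓕 g : L2 n)) : f = g :=
  (Lp.fourierTransformₗᵢ (Sp n) ℂ).injective (Lp.ext h)

/-- The entry at the multi-index `0` determines the whole jet, and its transform vanishes off the
high frequencies. -/
theorem highFn_injective {k : ℕ} {r : ℝ} {F G : HHigh n k r}
    (h : ∀ᵐ η ∂(volume.restrict (highSet n r)), (𝓕 (highFn F) : L2 n) η = (𝓕 (highFn G) : L2 n) η) :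
    F = G := by
  have h0 : (𝓕 (highFn F) : L2 n) =ᵐ[volume] (𝓕 (highFn G) : L2 n) := by
    filter_upwards [(ae_restrict_iff' (measurableSet_highSet n r)).1 h, fourier_highFn_eq_zero F,
      fourier_highFn_eq_zero G] with η h1 h2 h3
    by_cases hη : η ∈ highSet n r
    · exact h1 hη
    · rw [h2 hη, h3 hη]
  apply Subtype.ext
  ext1 α
  refine eq_of_fourier_ae_eq ?_
  filter_upwards [h0, fourier_jet_eq F α, fourier_jet_eq G α] with η h1 h2 h3
  rw [h2, h3, h1]

/-- The weighted Fourier transform `F ↦ w_k F̂` on high frequencies. -/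
def weightedFourier (n k : ℕ) (r : ℝ) :
    HHigh n k r →L[ℂ] Lp ℂ 2 ((volume : Measure (Sp n)).restrict (highSet n r)) :=
  ∑ α : MultiIndex n k, restrictL2 volume (highSet n r) ∘L
    mulL2 (fun η => (starRingEnd ℂ) (normSymbol k (fun i => (α.1 i : ℕ)) η))
      (Complex.continuous_conj.comp (continuous_normSymbol k _))
      (fun η => by rw [RCLike.norm_conj]; exact norm_normSymbol_le_one α.2 η) ∘L
    (Lp.fourierTransformₗᵢ (Sp n) ℂ).toContinuousLinearEquiv.toContinuousLinearMap ∘L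
    PiLp.proj 2 (fun _ : MultiIndex n k => L2 n) α ∘L (HHigh n k r).subtypeL

theorem coeFn_weightedFourier {k : ℕ} {r : ℝ} (F : HHigh n k r) :
    weightedFourier n k r F =ᵐ[volume.restrict (highSet n r)]
      fun η => (weight k ((2 * Real.pi) • η) : ℂ) * (𝓕 (highFn F) : L2 n) η := by
  have hsum : weightedFourier n k r F = ∑ α : MultiIndex n k,
      restrictL2 volume (highSet n r) (mulL2
        (fun η => (starRingEnd ℂ) (normSymbol k (fun i => (α.1 i : ℕ)) η))
        (Complex.continuous_conj.comp (continuous_normSymbol k _))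
        (fun η => by rw [RCLike.norm_conj]; exact norm_normSymbol_le_one α.2 η)
        (𝓕 ((F : PiLp 2 fun _ : MultiIndex n k => L2 n) α))) := by
    rw [weightedFourier, sum_apply]
    rfl
  rw [hsum]
  have h1 := ae_all_iff.2 fun α : MultiIndex n k =>
    coeFn_restrictL2 (μ := volume) (highSet n r) (mulL2
      (fun η => (starRingEnd ℂ) (normSymbol k (fun i => (α.1 i : ℕ)) η))
      (Complex.continuous_conj.comp (continuous_normSymbol k _))
      (fun η => by rw [RCLike.norm_conj]; exact norm_normSymbol_le_one α.2 η)
      (𝓕 ((F : PiLp 2 fun _ : MultiIndex n k => L2 n) α)))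
  have h2 := ae_restrict_of_ae (s := highSet n r) (ae_all_iff.2 fun α : MultiIndex n k =>
    coeFn_mulL2
      (fun η => (starRingEnd ℂ) (normSymbol k (fun i => (α.1 i : ℕ)) η))
      (Complex.continuous_conj.comp (continuous_normSymbol k _))
      (fun η => by rw [RCLike.norm_conj]; exact norm_normSymbol_le_one α.2 η)
      (𝓕 ((F : PiLp 2 fun _ : MultiIndex n k => L2 n) α)))
  have h3 := ae_restrict_of_ae (s := highSet n r) (ae_all_iff.2 fun α => fourier_jet_eq F α)
  filter_upwards [Lp.coeFn_fun_finsetSum Finset.univ fun α : MultiIndex n k =>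
      restrictL2 volume (highSet n r) (mulL2
        (fun η => (starRingEnd ℂ) (normSymbol k (fun i => (α.1 i : ℕ)) η))
        (Complex.continuous_conj.comp (continuous_normSymbol k _))
        (fun η => by rw [RCLike.norm_conj]; exact norm_normSymbol_le_one α.2 η)
        (𝓕 ((F : PiLp 2 fun _ : MultiIndex n k => L2 n) α))), h1, h2, h3] with η e0 e1 e2 e3
  rw [e0]
  simp only [e1, e2, e3, ← mul_assoc]
  rw [← Finset.sum_mul, sum_conj_normSymbol_mul]

/-- The inverse of the weighted Fourier transform, with values in all of the jets. -/
def weightedFourierInvAux (n k : ℕ) (r : ℝ) :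
    Lp ℂ 2 ((volume : Measure (Sp n)).restrict (highSet n r)) →L[ℂ]
      PiLp 2 fun _ : MultiIndex n k => L2 n :=
  (PiLp.continuousLinearEquiv 2 ℂ fun _ : MultiIndex n k => L2 n).symm.toContinuousLinearMap ∘L
    ContinuousLinearMap.pi fun α : MultiIndex n k =>
      (Lp.fourierTransformₗᵢ (Sp n) ℂ).symm.toContinuousLinearEquiv.toContinuousLinearMap ∘L
      mulL2 (normSymbol k (fun i => (α.1 i : ℕ))) (continuous_normSymbol k _)
        (norm_normSymbol_le_one α.2) ∘L extendL2 volume (measurableSet_highSet n r)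

theorem fourier_weightedFourierInvAux {k : ℕ} {r : ℝ}
    (g : Lp ℂ 2 ((volume : Measure (Sp n)).restrict (highSet n r))) (α : MultiIndex n k) :
    (𝓕 (weightedFourierInvAux n k r g α) : L2 n) =ᵐ[volume] fun η =>
      normSymbol k (fun i => (α.1 i : ℕ)) η * (highSet n r).indicator (fun x => g x) η := by
  have h : (𝓕 (weightedFourierInvAux n k r g α) : L2 n) =
      mulL2 (normSymbol k (fun i => (α.1 i : ℕ))) (continuous_normSymbol k _)
        (norm_normSymbol_le_one α.2) (extendL2 volume (measurableSet_highSet n r) g) :=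
    (Lp.fourierTransformₗᵢ (Sp n) ℂ).apply_symm_apply _
  rw [h]
  filter_upwards [coeFn_mulL2 (normSymbol k (fun i => (α.1 i : ℕ))) (continuous_normSymbol k _)
    (norm_normSymbol_le_one α.2) (extendL2 volume (measurableSet_highSet n r) g),
    coeFn_extendL2 (measurableSet_highSet n r) g] with η h1 h2
  rw [h1, h2]

theorem normSymbol_zero (k : ℕ) (η : Sp n) :
    normSymbol k (fun i => ((MultiIndex.zero n k).1 i : ℕ)) η =
      ((weight k ((2 * Real.pi) • η) : ℝ) : ℂ)⁻¹ := by
  simp [normSymbol, derivSymbol, MultiIndex.zero]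

/-- The zeroth entry has transform `g / w_k`, so the entry at `α` has `(iξ)^α` times that; the
indicator enforces the support condition. -/
theorem weightedFourierInvAux_mem {k : ℕ} {r : ℝ}
    (g : Lp ℂ 2 ((volume : Measure (Sp n)).restrict (highSet n r))) :
    weightedFourierInvAux n k r g ∈ HHigh n k r := by
  refine ⟨fun α => ?_, ?_⟩
  · refine (((hasFourier_toDistr (weightedFourierInvAux n k r g (MultiIndex.zero n k))).multiDeriv
      fun i => (α.1 i : ℕ)).toDistr_eq_iff _).2 ?_
    filter_upwards [fourier_weightedFourierInvAux g α,
      fourier_weightedFourierInvAux g (MultiIndex.zero n k)] with η h1 h2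
    rw [h1, h2, normSymbol_zero, ← mul_assoc, ← div_eq_mul_inv]
    rfl
  · change ∀ᵐ η : Sp n, ‖(2 * Real.pi) • η‖ < r →
      (𝓕 (weightedFourierInvAux n k r g (MultiIndex.zero n k)) : L2 n) η = 0
    filter_upwards [fourier_weightedFourierInvAux g (MultiIndex.zero n k)] with η h1 hr
    rw [h1, Set.indicator_of_notMem (fun h : η ∈ highSet n r => absurd hr (not_lt.2 h)), mul_zero]

/-- The inverse of the weighted Fourier transform. -/
def weightedFourierInv (n k : ℕ) (r : ℝ) :
    Lp ℂ 2 ((volume : Measure (Sp n)).restrict (highSet n r)) →L[ℂ] HHigh n k r :=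
  (weightedFourierInvAux n k r).codRestrict (HHigh n k r) weightedFourierInvAux_mem

theorem fourier_highFn_weightedFourierInv {k : ℕ} {r : ℝ}
    (g : Lp ℂ 2 ((volume : Measure (Sp n)).restrict (highSet n r))) :
    ∀ᵐ η ∂(volume.restrict (highSet n r)), (𝓕 (highFn (weightedFourierInv n k r g)) : L2 n) η =
      ((weight k ((2 * Real.pi) • η) : ℝ) : ℂ)⁻¹ * g η := by
  rw [ae_restrict_iff' (measurableSet_highSet n r)]
  filter_upwards [fourier_weightedFourierInvAux g (MultiIndex.zero n k)] with η h1 hη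
  rw [normSymbol_zero, Set.indicator_of_mem hη] at h1
  exact h1

/-- The weighted Fourier transform identifies `H^k_(∞)` with `L²` on the high frequencies. -/
def weightedFourierEquiv (n k : ℕ) (r : ℝ) :
    HHigh n k r ≃L[ℂ] Lp ℂ 2 ((volume : Measure (Sp n)).restrict (highSet n r)) :=
  ContinuousLinearEquiv.equivOfInverse (weightedFourier n k r) (weightedFourierInv n k r)
    (fun F => by
      refine highFn_injective ?_
      filter_upwards [fourier_highFn_weightedFourierInv (weightedFourier n k r F),
        coeFn_weightedFourier F] with η h1 h2
      rw [h1, h2, inv_mul_cancel_left₀ (Complex.ofReal_ne_zero.2 (weight_pos _ _).ne')])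
    (fun g => by
      refine Lp.ext ?_
      filter_upwards [fourier_highFn_weightedFourierInv g,
        coeFn_weightedFourier (weightedFourierInv n k r g)] with η h1 h2
      rw [h2, h1, mul_inv_cancel_left₀ (Complex.ofReal_ne_zero.2 (weight_pos _ _).ne')])

/-- The weighted Fourier transform of `u = (φ, m)`. -/
def stateEquiv (n s : ℕ) (r : ℝ) :
    X n s r ≃L[ℂ] Lp (Val n) 2 ((volume : Measure (Sp n)).restrict (highSet n r)) :=
  withLpValEquiv n (weightedFourierEquiv n s r) (weightedFourierEquiv n (s - 1) r)

/-- The Fourier transform `(φ̂, m̂)`. -/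
def X.hat {s : ℕ} {r : ℝ} (u : X n s r) (η : Sp n) : Val n :=
  ((𝓕 u.phi : L2 n) η, fun j => (𝓕 (u.mom j) : L2 n) η)

theorem coeFn_stateEquiv {s : ℕ} {r : ℝ} (u : X n s r) :
    stateEquiv n s r u =ᵐ[volume.restrict (highSet n r)] fun η =>
      scaleVal n (weight s ((2 * Real.pi) • η)) (weight (s - 1) ((2 * Real.pi) • η)) (u.hat η) := by
  filter_upwards [coeFn_withLpValEquiv n (weightedFourierEquiv n s r)
      (weightedFourierEquiv n (s - 1) r) u, coeFn_weightedFourier u.fst,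
    ae_all_iff.2 fun j => coeFn_weightedFourier (u.snd j)] with η h1 h2 h3
  refine h1.trans (Prod.ext h2 (funext h3))

end SobolevEquiv

/-! ### `A` and the solution matrix in terms of Fourier transforms -/

section LinearizedSystem

variable {n s : ℕ} {r : ℝ} {ν ν' κ : ℝ}

/-- Every term of `A` is a distributional derivative of an `L²` function, hence has a locally
integrable transform. No smoothness of `u` beyond membership in `X` is required, which is what
yields the maximal domain. -/
theorem isA_iff (u v : X n s r) :
    IsA ν ν' κ u v ↔
      ∀ᵐ η : Sp n, v.hat η = -genSymbol ν ν' κ ((2 * Real.pi) • η) (u.hat η) := by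
  have hm : ∀ j, HasFourier (toDistr (u.mom j)) (fun η => (𝓕 (u.mom j) : L2 n) η) := fun j =>
    hasFourier_toDistr _
  have hdiv := hasFourier_divergence hm
  have h2 : ∀ j, HasFourier _ _ := fun j =>
    (((((hasFourier_toDistr u.phi).laplacian.lineDeriv j).smul (κ : ℂ)).neg.sub
      ((hm j).laplacian.smul (ν : ℂ))).sub ((hdiv.lineDeriv j).smul (ν' : ℂ)))
  have key : ∀ᵐ η : Sp n, (v.hat η = -genSymbol ν ν' κ ((2 * Real.pi) • η) (u.hat η) ↔
      (𝓕 v.phi : L2 n) η = _ ∧ ∀ j, (𝓕 (v.mom j) : L2 n) η = _) :=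
    Eventually.of_forall fun η => by
      rw [genSymbol_apply, Prod.ext_iff, funext_iff]
      rfl
  rw [IsA, hdiv.toDistr_eq_iff, forall_congr' fun j => (h2 j).toDistr_eq_iff _, eventually_congr key,
    eventually_and, ae_all_iff]
  refine and_congr ?_ (forall_congr' fun j => ?_)
  · refine eventually_congr (Eventually.of_forall fun η => ?_)
    refine Eq.congr rfl ?_
    simp only [X.hat, Prod.fst_neg, neg_mul, neg_neg, Finset.mul_sum, mul_assoc,
      Finset.sum_neg_distrib]
  · refine eventually_congr (Eventually.of_forall fun η => ?_)
    refine Eq.congr rfl ?_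
    have h3 : ∑ i, Complex.I * (((2 * Real.pi) • η) i : ℝ) * (𝓕 (u.mom i) : L2 n) η =
        Complex.I * ∑ i, ((((2 * Real.pi) • η) i : ℝ) : ℂ) * (𝓕 (u.mom i) : L2 n) η := by
      rw [Finset.mul_sum]
      exact Finset.sum_congr rfl fun i _ => mul_assoc _ _ _
    simp only [X.hat, Prod.snd_neg, Pi.neg_apply, h3]
    linear_combination (-(ν' : ℂ) * (((2 * Real.pi) • η) j : ℝ) *
      ∑ i, ((((2 * Real.pi) • η) i : ℝ) : ℂ) * (𝓕 (u.mom i) : L2 n) η) * Complex.I_sq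

theorem isSolutionAt_iff (t : ℝ) (u v : X n s r) :
    IsSolutionAt ν ν' κ t u v ↔
      ∀ᵐ η : Sp n, v.hat η = solVec ν ν' κ ((2 * Real.pi) • η) (u.hat η) t := by
  have key : ∀ η : Sp n, (v.hat η = solVec ν ν' κ ((2 * Real.pi) • η) (u.hat η) t ↔
      (𝓕 v.phi : L2 n) η = _ ∧ ∀ j, (𝓕 (v.mom j) : L2 n) η = _) :=
    fun η => by
      rw [solVec, Prod.ext_iff, funext_iff]
      rfl
  rw [IsSolutionAt, eventually_congr (Eventually.of_forall key), eventually_and, ae_all_iff]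
  rfl

theorem hat_eq_zero (u : X n s r) : ∀ᵐ η : Sp n, η ∉ highSet n r → u.hat η = 0 := by
  filter_upwards [fourier_highFn_eq_zero u.fst,
    ae_all_iff.2 fun j => fourier_highFn_eq_zero (u.snd j)] with η h1 h2 hη
  exact Prod.ext (h1 hη) (funext fun j => h2 j hη)

theorem hat_neg (u : X n s r) : ∀ᵐ η : Sp n, (-u).hat η = -u.hat η := by
  have h : ∀ f : L2 n, ∀ᵐ η : Sp n, (𝓕 (-f) : L2 n) η = -(𝓕 f : L2 n) η := fun f => by
    have h1 : (𝓕 (-f) : L2 n) = -𝓕 f := map_neg (Lp.fourierTransformₗᵢ (Sp n) ℂ) f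
    rw [h1]
    exact Lp.coeFn_neg _
  filter_upwards [h u.phi, ae_all_iff.2 fun j => h (u.mom j)] with η h1 h2
  exact Prod.ext h1 (funext h2)

/-- Relations between Fourier transforms only have to be checked at high frequencies. -/
theorem ae_hat_eq_iff (u v : X n s r) {G : Sp n → Val n → Val n} (hG : ∀ η, G η 0 = 0) :
    (∀ᵐ η ∂(volume.restrict (highSet n r)), v.hat η = G η (u.hat η)) ↔
      ∀ᵐ η : Sp n, v.hat η = G η (u.hat η) := by
  refine ⟨fun h => ?_, ae_restrict_of_ae⟩
  filter_upwards [(ae_restrict_iff' (measurableSet_highSet n r)).1 h, hat_eq_zero u,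
    hat_eq_zero v] with η h1 h2 h3
  by_cases hη : η ∈ highSet n r
  · exact h1 hη
  · rw [h2 hη, h3 hη, hG]

theorem scaleVal_weight_injective (k l : ℕ) (ξ : Sp n) :
    Function.Injective (scaleVal n (weight k ξ) (weight l ξ)) :=
  Function.LeftInverse.injective (scaleVal_inv_scaleVal k l ξ)

theorem solVec_zero_right (ξ : Sp n) (t : ℝ) : solVec ν ν' κ ξ 0 t = 0 := by
  ext i <;> simp [solVec]

end LinearizedSystem

/-! ### The solution semigroup on `X` -/

section SolutionOperator

variable {n k : ℕ} {r ν ν' κ : ℝ}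

theorem exists_isStableSymbol (n k : ℕ) (hr : 0 < r) (hν₀ : 0 ≤ ν) (hν : 0 < ν + ν')
    (hκ : 0 < κ) :
    ∃ C : ℝ, IsStableSymbol (fun η : Sp n => wSymbol ν ν' κ k ((2 * Real.pi) • η))
      (volume.restrict (highSet n r)) C := by
  obtain ⟨C, hC⟩ := exists_norm_exp_wSymbol_le n hν₀ hν hκ k hr
  have hc : Continuous fun η : Sp n => wSymbol ν ν' κ k ((2 * Real.pi) • η) :=
    (continuous_wSymbol k).comp (continuous_const_smul _)
  refine ⟨C, hc.aestronglyMeasurable, ?_⟩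
  filter_upwards [ae_restrict_mem (measurableSet_highSet n r)] with η hη
  exact hC _ hη

variable {C : ℝ} (hb : IsStableSymbol (fun η : Sp n => wSymbol ν ν' κ k ((2 * Real.pi) • η))
  (volume.restrict (highSet n r)) C)

/-- The solution semigroup of the linearized Navier–Stokes–Korteweg system at high
frequencies. -/
def solutionOp (t : ℝ≥0) : X n (k + 1) r →L[ℂ] X n (k + 1) r :=
  conjFamily (stateEquiv n (k + 1) r) (mulSemigroup hb) t

theorem stateEquiv_solutionOp (t : ℝ≥0) (u : X n (k + 1) r) :
    stateEquiv n (k + 1) r (solutionOp hb t u) = mulSemigroup hb t (stateEquiv n (k + 1) r u) :=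
  (stateEquiv n (k + 1) r).apply_symm_apply _

theorem isSolutionAt_solutionOp (hr : 0 < r) (hν : 0 < ν + ν') (hκ : 0 < κ) (t : ℝ≥0)
    (u : X n (k + 1) r) : IsSolutionAt ν ν' κ t u (solutionOp hb t u) := by
  rw [isSolutionAt_iff, ← ae_hat_eq_iff (G := fun η v => solVec ν ν' κ ((2 * Real.pi) • η) v t) _ _
    fun η => solVec_zero_right _ _]
  have h1 := coeFn_stateEquiv (solutionOp hb t u)
  rw [stateEquiv_solutionOp] at h1
  filter_upwards [h1, coeFn_mulSemigroup hb t (stateEquiv n (k + 1) r u), coeFn_stateEquiv u,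
    ae_restrict_mem (measurableSet_highSet n r)] with η e1 e2 e3 hη
  -- The cutoff `r > 0` keeps `ξ` away from the origin, where the matrix formula divides by `|ξ|²`.
  have hξ : (2 * Real.pi) • η ≠ 0 := norm_pos_iff.1 (hr.trans_le hη)
  refine scaleVal_weight_injective (k + 1) k ((2 * Real.pi) • η) ?_
  rw [← exp_wSymbol_scaleVal hν hκ k hξ]
  refine e1.symm.trans (e2.trans ?_)
  rw [e3]
  rfl

/-- The weights are invertible at each frequency, so they cancel from `w_X ŵ = b (w_X û)` and leave
the unweighted symbol of `-A`. -/
theorem isGeneratorAt_solutionOp_iff (u w : X n (k + 1) r) :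
    IsGeneratorAt (solutionOp hb) u w ↔ IsA ν ν' κ u (-w) := by
  refine (isGeneratorAt_conj_iff (stateEquiv n (k + 1) r) u w).trans ?_
  rw [isGeneratorAt_mulSemigroup_iff, isA_iff]
  have h1 : (∀ᵐ η : Sp n, (-w).hat η = -genSymbol ν ν' κ ((2 * Real.pi) • η) (u.hat η)) ↔
      ∀ᵐ η : Sp n, w.hat η = genSymbol ν ν' κ ((2 * Real.pi) • η) (u.hat η) := by
    refine eventually_congr ?_
    filter_upwards [hat_neg w] with η hη
    rw [hη, neg_inj]
  rw [h1, ← ae_hat_eq_iff (G := fun η v => genSymbol ν ν' κ ((2 * Real.pi) • η) v) _ _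
    fun η => map_zero _]
  refine eventually_congr ?_
  filter_upwards [coeFn_stateEquiv u, coeFn_stateEquiv w] with η e1 e2
  rw [e1, e2]
  refine Iff.trans (Eq.congr rfl (wSymbol_scaleVal k _ _)) ?_
  exact (scaleVal_weight_injective (k + 1) k ((2 * Real.pi) • η)).eq_iff

theorem continuous_solutionOp_apply (u : X n (k + 1) r) : Continuous fun t => solutionOp hb t u :=
  (stateEquiv n (k + 1) r).symm.continuous.comp
    (continuous_mulSemigroup_apply hb (stateEquiv n (k + 1) r u))

end SolutionOperator

end NSK

end

theorem proposition4p3 (n s : ℕ) (hn : 3 ≤ n) (hs : n / 2 + 1 ≤ s)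
    (μ μ' κ r₁ : ℝ) (hμ : 0 < μ) (hμ' : 0 ≤ 2 / n * μ + μ') (hκ : 0 < κ) (hr₁ : 0 < r₁) :
    ∃ S : ℝ≥0 → NSK.X n s r₁ →L[ℂ] NSK.X n s r₁,
      -- `S` is the solution operator given by the explicit Fourier multiplier
      (∀ (t : ℝ≥0) (u : NSK.X n s r₁), NSK.IsSolutionAt μ (μ + μ') κ t u (S t u)) ∧
      NSK.IsC0Semigroup S ∧
      -- the infinitesimal generator of `S` is `-A`
      (∀ u w : NSK.X n s r₁, NSK.IsGeneratorAt S u w ↔ NSK.IsA μ (μ + μ') κ u (-w)) ∧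
      (∀ T : ℝ≥0, 0 < T → ∀ u₀ : ℝ≥0 → NSK.X n s r₁, ContinuousOn u₀ (Set.Icc 0 T) →
        ContinuousOn (fun t => S t (u₀ t)) (Set.Icc 0 T)) ∧
      ∃ C : ℝ, 0 < C ∧ ∀ (t : ℝ≥0) (u₀ : NSK.X n s r₁), ‖S t u₀‖ ≤ C * ‖u₀‖ := by
  have hn' : (3 : ℝ) ≤ n := by exact_mod_cast hn
  -- Since `2/n < 2`, the sum `2μ + μ'` strictly exceeds `(2/n)μ + μ' ≥ 0`.
  have hν : 0 < μ + (μ + μ') := by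
    have h1 : 2 / (n : ℝ) < 2 := by
      rw [div_lt_iff₀ (by linarith)]
      linarith
    nlinarith
  -- `s ≥ 1`, so the truncated `s - 1` is a true predecessor and the two weights differ by exactly
  -- one order.
  obtain ⟨k, rfl⟩ : ∃ k, s = k + 1 := ⟨s - 1, by omega⟩
  obtain ⟨C, hb⟩ := NSK.exists_isStableSymbol n k hr₁ hμ.le hν hκ
  obtain ⟨C', hC'0, hC'⟩ := NSK.exists_norm_conjFamily_le (NSK.stateEquiv n (k + 1) r₁)
    (NSK.norm_mulSemigroup_le hb)
  refine ⟨NSK.solutionOp hb, NSK.isSolutionAt_solutionOp hb hr₁ hν hκ,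
    (NSK.isC0Semigroup_mulSemigroup hb).conj (NSK.stateEquiv n (k + 1) r₁),
    NSK.isGeneratorAt_solutionOp_iff hb, fun T _ u₀ hu₀ => ?_, C', hC'0, hC'⟩
  exact NSK.continuousOn_apply_of_bounded hC' (NSK.continuous_solutionOp_apply hb) hu₀
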